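/- Let $X=\{0,1\}^{\mathbb N}$ be the group of sequences $x=(x_1,x_2,\dots)$ under addition modulo $2$, with the $\sigma$-algebra generated by the sets $\{x:x_k=1\}$; let $\delta_k$ be the sequence whose only nonzero entry is the $k$-th, $\Delta\subset X$ the subgroup generated by the $\delta_k$, and $1-x=(1-x_1,1-x_2,\dots)$. Let $Z$ be an infinite-dimensional separable real (pre-)Hilbert space with a compatible complex structure $\sigma$ and a unitary basis $z_1,z_2,\dots$ of $(Z,\sigma)$, i.e. $\{z_k,\sigma z_k\}$ is a real orthonormal basis, and let $C(Z)$ be its Clifford algebra, with relations $zw+wz=-2(z,w)$. A *GW triple* $(\mu,\nu,\{c_k\})$ consists of a $\sigma$-finite measure $\mu$ on $X$ whose translates by elements of $\Delta$ are all equivalent to $\mu$; a measurable $\nu:X\to\{1,2,\dots,\infty\}$ with $\nu(x+\delta)=\nu(x)$ for each $\delta\in\Delta$ and almost all $x$; and unitary operators $c_k(x)$ of $H_x$, measurable in $x$, such that for almost all $x$ $$c_k(x)^*=c_k(x+\delta_k),\qquad c_k(x)c_l(x+\delta_k)=c_l(x)c_k(x+\delta_l).$$ Here $H_x=\mathbb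 C\otimes K_x$, where $K_x$ is the standard real Hilbert space of dimension $\nu(x)$ (sequences in $\ell^2(\mathbb N,\mathbb R)$ supported in the first $\nu(x)$ places), so that $H_{x+\delta}=H_x$ almost everywhere; $\bar{\ }$ denotes the conjugation of $H_x$ with respect to $K_x$, and $\overline{A}\,v=\overline{A\bar v}$ for an operator $A$. On $H=\int_X^\oplus H_x\,d\mu(x)$ the formulas $$(J_{z_k}f)(x)=(-1)^{x_1+\dots+x_{k-1}+1}\,i\,c_k(x)\sqrt{\tfrac{d\mu(x+\delta_k)}{d\mu(x)}}\,f(x+\delta_k),\qquad (J_{\sigma z_k}f)(x)=(-1)^{x_k}\,i\,(J_{z_k}f)(x)$$ determine a unique representation of $C(Z)$ that is continuous on $Z$; $H$ with this representation is the *GW module* of the triple. An *invariant real form* of $H$ is a $C(Z)$-invariant real subspace $V$ with $H=V\oplus iV$ on which the inner product of $H$ is real-valued. Put $\tilde\mu(E)=\mu(1-E)$. **Theorem.** (1) The formulas above define one and only one such representation for every GW triple. If moreover $\tilde\mu$ and $\mu$ are equivalent and, for almost all $x$ and all $k\ge1$, $$\nu(1-x)=\nu(x),\qquad \overline{c_k(1-x)}=(-1)^k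 c_k(x),$$ then $$H^{\mathbb R}=\Big\{f\in H:\ \overline{f(x)}=\sqrt{\tfrac{d\mu(1-x)}{d\mu(x)}}\,f(1-x)\ \text{for almost all }x\Big\},\qquad \tfrac{d\mu(1-x)}{d\mu(x)}:=\tfrac{d\tilde\mu}{d\mu}(x),$$ is an invariant real form of $H$. (2) Conversely, for every GW module $H$ and every invariant real form $V$ of $H$ there are a GW triple satisfying the conditions of (1), with module $H'$ and real form $H'^{\,\mathbb R}$, and a unitary isomorphism $U:H\to H'$ that intertwines the representations of $C(Z)$ and satisfies $U(V)=H'^{\,\mathbb R}$. -/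

import Mathlib

open MeasureTheory

noncomputable section

namespace GW

/-! ### Sequences of occupation numbers -/

/-- The group of sequences of `0`s and `1`s under componentwise addition modulo `2`, with the
σ-algebra generated by the sets `{x | x k = 1}`.  Coordinates are indexed from `0`: the index
`k : ℕ` here is the `(k + 1)`-st coordinate. -/
abbrev X : Type := ℕ → ZMod 2

/-- The subgroup of sequences with only finitely many `1`s. -/
def Delta : AddSubgroup X where
  carrier := {x | {k | x k ≠ 0}.Finite}
  zero_mem' := by simp
  add_mem' := by
    intro a b ha hb
    refine (Set.Finite.union ha hb).subset ?_
    intro k hk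
    by_cases h : a k = 0
    · exact Or.inr fun h' => hk (by simp [h, h'])
    · exact Or.inl h
  neg_mem' := by
    intro a ha
    simpa using ha

/-- The sequence whose only nonzero component is the `k`-th. -/
def delta (k : ℕ) : X := Pi.single k 1

/-! ### The fibres -/

/-- The space `ℓ²(ℕ, ℂ)`, in which the fibres are realized.  Complex conjugation with respect to
the real form `ℓ²(ℕ, ℝ)` is `star`, taken in each coordinate. -/
abbrev E : Type := lp (fun _ : ℕ => ℂ) 2

/-- The standard Hilbert space of dimension `n ∈ {0, 1, …, ∞}`: the sequences supported in
`{0, …, n - 1}`.  It is the complexification of the real sequences it contains. -/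
def fiber (n : ℕ∞) : Submodule ℂ E where
  carrier := {v | ∀ i : ℕ, n ≤ (i : ℕ∞) → v i = 0}
  zero_mem' := by intro i _; simp
  add_mem' := by
    intro a b ha hb i hi
    simp [ha i hi, hb i hi]
  smul_mem' := by
    intro c a ha i hi
    simp [ha i hi]

/-- `A` is a unitary operator of the subspace `F` (extended by zero to the orthogonal complement
of `F`, so that operators on different fibres can be composed and compared). -/
structure IsUnitaryOn (F : Submodule ℂ E) (A : E →L[ℂ] E) : Prop where
  norm_map : ∀ v ∈ F, ‖A v‖ = ‖v‖
  map_eq : F.map (A : E →ₗ[ℂ] E) = F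
  map_orthogonal : ∀ v ∈ Fᗮ, A v = 0

/-! ### The triples -/

/-- A triple `(μ, ν, {c_k})`.  The fibre over `x` is `H_x = fiber (ν x)`, so that
`H_{x + δ} = H_x` for almost all `x`. -/
structure Triple where
  /-- the measure -/
  μ : Measure X
  sigmaFinite : SigmaFinite μ
  /-- `μ` is quasi-invariant: all its translates by elements of `Delta` are equivalent to it -/
  quasiInvariant : ∀ δ ∈ Delta, μ.map (fun x => x + δ) ≪ μ ∧ μ ≪ μ.map (fun x => x + δ)
  /-- the dimension function -/
  ν : X → ℕ∞
  measurable_ν : Measurable ν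
  one_le_ν : ∀ x, 1 ≤ ν x
  ν_add : ∀ δ ∈ Delta, ∀ᵐ x ∂μ, ν (x + δ) = ν x
  /-- the unitary operators -/
  c : ℕ → X → (E →L[ℂ] E)
  measurable_c : ∀ k v, AEStronglyMeasurable (fun x => c k x v) μ
  unitary_c : ∀ k, ∀ᵐ x ∂μ, IsUnitaryOn (fiber (ν x)) (c k x)
  adjoint_c : ∀ k, ∀ᵐ x ∂μ, ContinuousLinearMap.adjoint (c k x) = c k (x + delta k)
  comm_c : ∀ k l, ∀ᵐ x ∂μ, c k x ∘L c l (x + delta k) = c l x ∘L c k (x + delta l)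

namespace Triple

variable (D : Triple)

/-- The direct integral `∫^⊕ H_x dμ(x)`: the square-integrable `f` with `f x ∈ H_x` for almost
all `x`. -/
def space : Submodule ℂ (Lp E 2 D.μ) where
  carrier := {f | ∀ᵐ x ∂D.μ, f x ∈ fiber (D.ν x)}
  zero_mem' := by
    filter_upwards [Lp.coeFn_zero E 2 D.μ] with x hx
    rw [hx]
    exact Submodule.zero_mem _
  add_mem' := by
    intro f g hf hg
    filter_upwards [hf, hg, Lp.coeFn_add f g] with x h1 h2 h
    rw [h]
    exact Submodule.add_mem _ h1 h2
  smul_mem' := by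
    intro a f hf
    filter_upwards [hf, Lp.coeFn_smul a f] with x h1 h
    rw [h]
    exact Submodule.smul_mem _ a h1

/-- The derivative `dμ(x + δ_k) / dμ(x)`. -/
def shiftDensity (k : ℕ) (x : X) : ℝ :=
  ((D.μ.map (fun y => y + delta k)).rnDeriv D.μ x).toReal

/-- The measure `E ↦ μ(1 - E)`. -/
def reflected : Measure X := D.μ.map (fun x => 1 - x)

/-- The derivative `dμ(1 - x) / dμ(x)`. -/
def reflDensity (x : X) : ℝ := (D.reflected.rnDeriv D.μ x).toReal

end Triple

/-! ### The Clifford algebra -/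

/-- The quadratic form `z ↦ -(z, z)`; its Clifford algebra is the quotient of the tensor algebra
of `Z` by the relations `z₁ z₂ + z₂ z₁ + 2 (z₁, z₂) = 0`. -/
def negForm (Z : Type*) [NormedAddCommGroup Z] [InnerProductSpace ℝ Z] : QuadraticForm ℝ Z :=
  -(LinearMap.BilinMap.toQuadraticMap (innerₗ Z))

/-- A complex structure `σ` on `Z` compatible with the metric, and a unitary basis `z_0, z_1, …`
of `(Z, σ)`: the vectors `z_k`, `σ z_k` form a real orthonormal basis of `Z`. -/
structure Frame (Z : Type*) [NormedAddCommGroup Z] [InnerProductSpace ℝ Z] where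
  σ : Z ≃ₗᵢ[ℝ] Z
  σ_σ : ∀ v, σ (σ v) = -v
  z : ℕ → Z
  orthonormal : Orthonormal ℝ (Sum.elim z (fun k => σ (z k)))
  dense : (Submodule.span ℝ (Set.range (Sum.elim z (fun k => σ (z k))))).topologicalClosure = ⊤

section Representations

variable {Z : Type*} [NormedAddCommGroup Z] [InnerProductSpace ℝ Z]

/-- `ρ` is the representation of the Clifford algebra of `Z` on the direct integral that belongs
to the triple `D`: it is continuous on `Z`, and on the basis it is given by
`(J_{z_k} f)(x) = (-1)^{x_1 + ⋯ + x_{k-1} + 1} i c_k(x) √(dμ(x + δ_k)/dμ(x)) f(x + δ_k)` and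
`(J_{σ z_k} f)(x) = (-1)^{x_k} i (J_{z_k} f)(x)`. -/
structure Triple.IsRep (D : Triple) (b : Frame Z)
    (ρ : CliffordAlgebra (negForm Z) →ₐ[ℝ] (D.space →L[ℂ] D.space)) : Prop where
  continuous : Continuous fun v : Z => ρ (CliffordAlgebra.ι (negForm Z) v)
  apply_z : ∀ (k : ℕ) (f : D.space), ∀ᵐ x ∂D.μ,
    (ρ (CliffordAlgebra.ι (negForm Z) (b.z k)) f : Lp E 2 D.μ) x =
      ((-1 : ℂ) ^ ((∑ j ∈ Finset.range k, (x j).val) + 1) * Complex.I) •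
        D.c k x (((√(D.shiftDensity k x) : ℝ) : ℂ) • (f : Lp E 2 D.μ) (x + delta k))
  apply_σz : ∀ (k : ℕ) (f : D.space), ∀ᵐ x ∂D.μ,
    (ρ (CliffordAlgebra.ι (negForm Z) (b.σ (b.z k))) f : Lp E 2 D.μ) x =
      ((-1 : ℂ) ^ (x k).val * Complex.I) •
        (ρ (CliffordAlgebra.ι (negForm Z) (b.z k)) f : Lp E 2 D.μ) x

/-- `V` is an invariant real form of the complex module `H`: it is a real subspace, invariant
under the Clifford algebra, with `H = V ⊕ iV`, and the inner product of `H` is real on `V`, so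
that `H` is the complexification of the real inner product space `V`. -/
structure IsInvariantRealForm {H : Type*} [NormedAddCommGroup H] [InnerProductSpace ℂ H]
    (ρ : CliffordAlgebra (negForm Z) →ₐ[ℝ] (H →L[ℂ] H)) (V : Submodule ℝ H) : Prop where
  invariant : ∀ a, ∀ f ∈ V, ρ a f ∈ V
  existsUnique_add : ∀ h : H, ∃! p : V × V, h = (p.1 : H) + Complex.I • (p.2 : H)
  inner_real : ∀ f ∈ V, ∀ g ∈ V, (inner ℂ f g).im = 0

end Representations

/-! ### The standard type -/

namespace Triple

variable (D : Triple)

/-- The triples of standard type: the measure `μ(1 - ·)` is equivalent to `μ`,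
`ν(1 - x) = ν(x)`, and the conjugate of `c_k(1 - x)` is `(-1)^k c_k(x)`, where the conjugate of
an operator `A` is `v ↦ conj (A (conj v))`.  With indices from `0` the sign is
`(-1)^(k + 1)`. -/
structure IsStandard : Prop where
  reflected_ac : D.reflected ≪ D.μ
  ac_reflected : D.μ ≪ D.reflected
  ν_refl : ∀ᵐ x ∂D.μ, D.ν (1 - x) = D.ν x
  c_refl : ∀ k, ∀ᵐ x ∂D.μ, ∀ v : E, star (D.c k (1 - x) (star v)) = (-1 : ℂ) ^ (k + 1) • D.c k x v

variable {D}

theorem IsStandard.quasi (h : D.IsStandard) :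
    Measure.QuasiMeasurePreserving (fun x : X => 1 - x) D.μ D.μ :=
  ⟨measurable_pi_lambda _ fun k => (measurable_of_countable fun t : ZMod 2 => 1 - t).comp
    (measurable_pi_apply k), h.reflected_ac⟩

/-- The real subspace of all `f` with `conj (f x) = √(dμ(1 - x)/dμ(x)) f(1 - x)` for almost
all `x`. -/
def IsStandard.realForm (h : D.IsStandard) : Submodule ℝ D.space where
  carrier := {f | ∀ᵐ x ∂D.μ, star ((f : Lp E 2 D.μ) x) =
    ((√(D.reflDensity x) : ℝ) : ℂ) • (f : Lp E 2 D.μ) (1 - x)}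
  zero_mem' := by
    have h0 := Lp.coeFn_zero E 2 D.μ
    filter_upwards [h0, h.quasi.ae h0] with x h1 h2
    simp only [Submodule.coe_zero, h1, h2, Pi.zero_apply, star_zero, smul_zero]
  add_mem' := by
    intro f g hf hg
    have h0 := Lp.coeFn_add (f : Lp E 2 D.μ) (g : Lp E 2 D.μ)
    change ∀ᵐ x ∂D.μ, star (((f + g : D.space) : Lp E 2 D.μ) x) =
      ((√(D.reflDensity x) : ℝ) : ℂ) • ((f + g : D.space) : Lp E 2 D.μ) (1 - x)
    filter_upwards [h0, h.quasi.ae h0, hf, hg] with x h1 h2 h3 h4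
    simp only [Submodule.coe_add, h1, h2, Pi.add_apply, star_add, smul_add, h3, h4]
  smul_mem' := by
    intro a f hf
    have h0 := Lp.coeFn_smul (a : ℂ) (f : Lp E 2 D.μ)
    change ∀ᵐ x ∂D.μ, star (((a • f : D.space) : Lp E 2 D.μ) x) =
      ((√(D.reflDensity x) : ℝ) : ℂ) • ((a • f : D.space) : Lp E 2 D.μ) (1 - x)
    filter_upwards [h0, h.quasi.ae h0, hf] with x h1 h2 h3
    change star (((a : ℂ) • (f : Lp E 2 D.μ) : Lp E 2 D.μ) x) =
      _ • ((a : ℂ) • (f : Lp E 2 D.μ) : Lp E 2 D.μ) (1 - x)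
    rw [h1, h2, Pi.smul_apply, Pi.smul_apply, star_smul, h3, smul_comm]
    simp

end Triple

end GW

end

/-!
An invariant real form is the fixed space of an antilinear involution `C` that commutes with the
Clifford algebra. Up to a sign and a factor `i`, the product of `J_{z_k}` and `J_{σ z_k}` is
multiplication by `(-1)^{x_k}`; as `C` is antilinear, it anticommutes with these multiplications,
so it covers the reflection `x ↦ 1 - x` of the base. Comparing norms, this makes `μ`
quasi-invariant under the reflection, and comparing fibres it makes `ν` symmetric, so that
`(C f)(x) = √(dμ(1 - x)/dμ(x)) conj (A(1 - x) f(1 - x))` for a field `A` of unitary operators.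
The reflection exchanges the halves `x₁ = 0` and `x₁ = 1` of the base, and a change of
trivialization by `A` on one half only turns `C` into the standard conjugation, whose commutation
with the `J_{z_k}` is the condition `conj (c_k(1 - x)) = (-1)^k c_k(x)`.
-/

noncomputable section

namespace GW

open scoped ENNReal

section SqrtDensity

variable {α : Type*} [MeasurableSpace α] {μ : Measure α} {φ ψ : α → α}

/-- An involution that is quasi-measure-preserving, so that it carries `μ` to an equivalent
measure. -/
structure QuasiInvolution (φ : α → α) (μ : Measure α) : Prop
    extends Measure.QuasiMeasurePreserving φ μ μ where
  involutive : Function.Involutive φ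

/-- The square root of the density of `μ.map φ` with respect to `μ`, the weight that makes
`f ↦ sqrtDensity μ φ • f ∘ φ` isometric on `L²(μ)`. -/
def sqrtDensity (μ : Measure α) (φ : α → α) (x : α) : ℝ := √((μ.map φ).rnDeriv μ x).toReal

theorem sqrtDensity_nonneg (φ : α → α) (x : α) : 0 ≤ sqrtDensity μ φ x := Real.sqrt_nonneg _

theorem measurable_sqrtDensity (φ : α → α) : Measurable (sqrtDensity μ φ) :=
  (Measure.measurable_rnDeriv _ _).ennreal_toReal.sqrt

theorem sqrtDensity_id [SigmaFinite μ] : ∀ᵐ x ∂μ, sqrtDensity μ id x = 1 := by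
  filter_upwards [Measure.rnDeriv_self μ] with x hx
  rw [sqrtDensity, Measure.map_id, hx, ENNReal.toReal_one, Real.sqrt_one]

namespace QuasiInvolution

protected theorem id (μ : Measure α) : QuasiInvolution id μ :=
  ⟨.id μ, fun _ => rfl⟩

theorem absolutelyContinuous_map (hφ : QuasiInvolution φ μ) : μ ≪ μ.map φ := by
  have h := hφ.absolutelyContinuous.map hφ.measurable
  rwa [Measure.map_map hφ.measurable hφ.measurable, hφ.involutive.comp_self, Measure.map_id] at h

variable [SigmaFinite μ]

theorem sigmaFinite_map (hφ : QuasiInvolution φ μ) : SigmaFinite (μ.map φ) := by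
  let e : α ≃ᵐ α := ⟨hφ.involutive.toPerm, hφ.measurable, hφ.measurable⟩
  exact e.sigmaFinite_map

theorem withDensity_rnDeriv (hφ : QuasiInvolution φ μ) :
    μ.withDensity ((μ.map φ).rnDeriv μ) = μ.map φ := by
  have := hφ.sigmaFinite_map
  exact Measure.withDensity_rnDeriv_eq _ _ hφ.absolutelyContinuous

theorem ofReal_sqrtDensity_sq (hφ : QuasiInvolution φ μ) :
    ∀ᵐ x ∂μ, ENNReal.ofReal (sqrtDensity μ φ x ^ 2) = (μ.map φ).rnDeriv μ x := by
  have := hφ.sigmaFinite_map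
  filter_upwards [Measure.rnDeriv_lt_top (μ.map φ) μ] with x hx
  rw [sqrtDensity, Real.sq_sqrt ENNReal.toReal_nonneg, ENNReal.ofReal_toReal hx.ne]

theorem map_withDensity (hφ : QuasiInvolution φ μ) {g : α → ℝ≥0∞} (hg : Measurable g) :
    (μ.withDensity g).map φ = μ.withDensity fun x => (μ.map φ).rnDeriv μ x * g (φ x) := by
  have map_eq : (μ.withDensity g).map φ = (μ.map φ).withDensity (g ∘ φ) := by
    ext s hs
    rw [Measure.map_apply hφ.measurable hs, withDensity_apply _ (hφ.measurable hs),
      withDensity_apply _ hs, setLIntegral_map hs (hg.comp hφ.measurable) hφ.measurable]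
    simp only [Function.comp_apply, hφ.involutive _]
  rw [map_eq]
  conv_lhs => rw [← hφ.withDensity_rnDeriv]
  exact (withDensity_mul _ (Measure.measurable_rnDeriv _ _) (hg.comp hφ.measurable)).symm

theorem lintegral_rnDeriv_mul_comp (hφ : QuasiInvolution φ μ) {g : α → ℝ≥0∞}
    (hg : Measurable g) : ∫⁻ x, (μ.map φ).rnDeriv μ x * g (φ x) ∂μ = ∫⁻ x, g x ∂μ := by
  have h := congrArg (· Set.univ) (hφ.map_withDensity hg)
  simpa [Measure.map_apply hφ.measurable MeasurableSet.univ] using h.symm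

theorem rnDeriv_map_comp (hφ : QuasiInvolution φ μ) (hψ : QuasiInvolution ψ μ) :
    (μ.map (φ ∘ ψ)).rnDeriv μ =ᵐ[μ]
      fun x => (μ.map φ).rnDeriv μ x * (μ.map ψ).rnDeriv μ (φ x) := by
  rw [← Measure.map_map hφ.measurable hψ.measurable, ← hψ.withDensity_rnDeriv,
    hφ.map_withDensity (Measure.measurable_rnDeriv _ _), hψ.withDensity_rnDeriv]
  exact Measure.rnDeriv_withDensity _ ((Measure.measurable_rnDeriv _ _).mul
    ((Measure.measurable_rnDeriv _ _).comp hφ.measurable))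

theorem sqrtDensity_comp (hφ : QuasiInvolution φ μ) (hψ : QuasiInvolution ψ μ) :
    ∀ᵐ x ∂μ, sqrtDensity μ φ x * sqrtDensity μ ψ (φ x) = sqrtDensity μ (φ ∘ ψ) x := by
  filter_upwards [hφ.rnDeriv_map_comp hψ] with x hx
  simp only [sqrtDensity, hx, ENNReal.toReal_mul, Real.sqrt_mul ENNReal.toReal_nonneg]

theorem sqrtDensity_mul_comm (hφ : QuasiInvolution φ μ) (hψ : QuasiInvolution ψ μ)
    (comm : φ ∘ ψ = ψ ∘ φ) :
    ∀ᵐ x ∂μ, sqrtDensity μ φ x * sqrtDensity μ ψ (φ x) =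
      sqrtDensity μ ψ x * sqrtDensity μ φ (ψ x) := by
  filter_upwards [hφ.sqrtDensity_comp hψ, hψ.sqrtDensity_comp hφ] with x h₁ h₂
  rw [h₁, h₂, comm]

theorem sqrtDensity_mul_self (hφ : QuasiInvolution φ μ) :
    ∀ᵐ x ∂μ, sqrtDensity μ φ x * sqrtDensity μ φ (φ x) = 1 := by
  filter_upwards [hφ.sqrtDensity_comp hφ, sqrtDensity_id] with x hx hx_id
  rw [hx, hφ.involutive.comp_self, hx_id]

theorem sqrtDensity_pos (hφ : QuasiInvolution φ μ) : ∀ᵐ x ∂μ, 0 < sqrtDensity μ φ x := by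
  filter_upwards [hφ.sqrtDensity_mul_self] with x hx
  exact (sqrtDensity_nonneg φ x).lt_of_ne' (left_ne_zero_of_mul_eq_one hx)

theorem eLpNorm_eq (hφ : QuasiInvolution φ μ) {F G : Type*} [NormedAddCommGroup F]
    [NormedAddCommGroup G] {f : α → F} {g : α → G} (hf : AEStronglyMeasurable f μ)
    (hg : ∀ᵐ x ∂μ, ‖g x‖ = sqrtDensity μ φ x * ‖f (φ x)‖) :
    eLpNorm g 2 μ = eLpNorm f 2 μ := by
  simp only [eLpNorm_eq_lintegral_rpow_enorm_toReal two_ne_zero ENNReal.ofNat_ne_top]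
  congr 1
  obtain ⟨f', hf', hff'⟩ := hf
  have lintegral_eq := lintegral_congr_ae (hff'.fun_comp fun v => ‖v‖ₑ ^ (2 : ℝ≥0∞).toReal)
  simp only [Function.comp_apply] at lintegral_eq
  rw [lintegral_eq,
    ← hφ.lintegral_rnDeriv_mul_comp (hf'.enorm.pow_const _)]
  refine lintegral_congr_ae ?_
  filter_upwards [hg, hφ.ofReal_sqrtDensity_sq, hφ.ae hff'] with x hgx hsq hfx
  rw [← hfx, ← hsq, ← ofReal_norm, ← ofReal_norm, hgx, ENNReal.toReal_ofNat,
    ENNReal.rpow_ofNat, ENNReal.rpow_ofNat, ENNReal.ofReal_mul (sqrtDensity_nonneg _ _), mul_pow,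
    ENNReal.ofReal_pow (sqrtDensity_nonneg _ _)]

end QuasiInvolution

end SqrtDensity

section HilbertBasisMeasurability

variable {𝕜 F ι α : Type*} [RCLike 𝕜] [NormedAddCommGroup F] [InnerProductSpace 𝕜 F]
  [Countable ι] [MeasurableSpace α] {μ : Measure α}

theorem aestronglyMeasurable_of_inner (b : HilbertBasis ι 𝕜 F) {f : α → F}
    (hf : ∀ i, AEStronglyMeasurable (fun x => inner 𝕜 (b i) (f x)) μ) :
    AEStronglyMeasurable f μ := by
  refine aestronglyMeasurable_of_tendsto_ae (Filter.atTop : Filter (Finset ι))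
    (f := fun s x => ∑ i ∈ s, inner 𝕜 (b i) (f x) • b i)
    (fun s => s.aestronglyMeasurable_fun_sum fun i _ => (hf i).smul_const _)
    (.of_forall fun x => ?_)
  have h := b.hasSum_repr (f x)
  simp only [b.repr_apply_apply] at h
  exact h

theorem aestronglyMeasurable_apply {σ : 𝕜 →+* 𝕜} [RingHomIsometric σ] {G : Type*}
    [NormedAddCommGroup G] [NormedSpace 𝕜 G] (b : HilbertBasis ι 𝕜 F) {A : α → F →SL[σ] G}
    {f : α → F} (hA : ∀ i, AEStronglyMeasurable (fun x => A x (b i)) μ)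
    (hf : AEStronglyMeasurable f μ) : AEStronglyMeasurable (fun x => A x (f x)) μ := by
  have continuous_σ : Continuous σ :=
    AddMonoidHomClass.continuous_of_bound σ 1 fun a => by rw [RingHomIsometric.norm_map, one_mul]
  refine aestronglyMeasurable_of_tendsto_ae (Filter.atTop : Filter (Finset ι))
    (f := fun s x => ∑ i ∈ s, σ (inner 𝕜 (b i) (f x)) • A x (b i))
    (fun s => s.aestronglyMeasurable_fun_sum fun i _ =>
      (continuous_σ.comp_aestronglyMeasurable (aestronglyMeasurable_const.inner hf)).smul (hA i))
    (.of_forall fun x => ?_)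
  have h := b.hasSum_repr (f x)
  simp only [b.repr_apply_apply] at h
  simpa only [HasSum, SummationFilter.unconditional_filter, Function.comp_def, map_smulₛₗ] using
    h.map (A x) (A x).continuous

theorem aestronglyMeasurable_adjoint [CompleteSpace F] {G : Type*} [NormedAddCommGroup G]
    [InnerProductSpace 𝕜 G] [CompleteSpace G] (b : HilbertBasis ι 𝕜 F) {A : α → F →L[𝕜] G}
    (hA : ∀ i, AEStronglyMeasurable (fun x => A x (b i)) μ) (v : G) :
    AEStronglyMeasurable (fun x => (A x).adjoint v) μ := by
  refine aestronglyMeasurable_of_inner b fun i => ?_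
  simpa only [ContinuousLinearMap.adjoint_inner_right] using
    (hA i).inner (aestronglyMeasurable_const (b := v)) (𝕜 := 𝕜)

end HilbertBasisMeasurability

/-- The standard Hilbert basis of `ℓ²(ℕ, ℂ)`; its first `n` vectors span a dense subspace of
`fiber n`. -/
def stdBasis : HilbertBasis ℕ ℂ E := .ofRepr (.refl ℂ E)

theorem inner_stdBasis (i : ℕ) (v : E) : inner ℂ (stdBasis i) v = v i :=
  (stdBasis.repr_apply_apply v i).symm

theorem stdBasis_apply (i j : ℕ) : stdBasis i j = if i = j then 1 else 0 := by
  rw [← inner_stdBasis, orthonormal_iff_ite.1 stdBasis.orthonormal]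
  simp only [eq_comm]

theorem star_stdBasis (i : ℕ) : star (stdBasis i) = stdBasis i := by
  ext j
  rw [lp.star_apply, stdBasis_apply]
  split_ifs <;> simp

theorem ext_stdBasis {σ : ℂ →+* ℂ} {G : Type*} [AddCommMonoid G] [Module ℂ G] [TopologicalSpace G]
    [T2Space G] {A B : E →SL[σ] G} (h : ∀ i, A (stdBasis i) = B (stdBasis i)) : A = B :=
  ContinuousLinearMap.ext_on (Submodule.dense_iff_topologicalClosure_eq_top.2 stdBasis.dense_span)
    (Set.forall_mem_range.2 h)

theorem mem_fiber {n : ℕ∞} {v : E} : v ∈ fiber n ↔ ∀ i : ℕ, n ≤ (i : ℕ∞) → v i = 0 := Iff.rfl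

theorem stdBasis_mem_fiber {n : ℕ∞} {i : ℕ} (hi : (i : ℕ∞) < n) : stdBasis i ∈ fiber n := by
  intro j hj
  rw [stdBasis_apply, if_neg]
  rintro rfl
  exact hi.not_ge hj

theorem stdBasis_mem_fiber_orthogonal {n : ℕ∞} {i : ℕ} (hi : n ≤ (i : ℕ∞)) :
    stdBasis i ∈ (fiber n)ᗮ := by
  intro v hv
  rw [← inner_conj_symm, inner_stdBasis, hv i hi, map_zero]

theorem star_mem_fiber {n : ℕ∞} {v : E} (hv : v ∈ fiber n) : star v ∈ fiber n := by
  intro i hi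
  rw [lp.star_apply, hv i hi, star_zero]

theorem isClosed_fiber (n : ℕ∞) : IsClosed (fiber n : Set E) := by
  have : (fiber n : Set E) =
      ⋂ (i : ℕ) (_ : n ≤ (i : ℕ∞)), {v : E | inner ℂ (stdBasis i) v = 0} := by
    ext v
    simp [mem_fiber, inner_stdBasis]
  rw [this]
  exact isClosed_iInter fun i => isClosed_iInter fun _ =>
    isClosed_eq (continuous_const.inner continuous_id) continuous_const

instance (n : ℕ∞) : CompleteSpace (fiber n) := (isClosed_fiber n).completeSpace_coe

section Clifford

open CliffordAlgebra (ι)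

section Uniqueness

variable {V κ A : Type*} [AddCommGroup V] [Module ℝ V] [TopologicalSpace V] [ContinuousAdd V]
  [ContinuousConstSMul ℝ V]
  {Q : QuadraticForm ℝ V} {w : κ → V} [Ring A] [Algebra ℝ A] [TopologicalSpace A]
  {ρ ρ' : CliffordAlgebra Q →ₐ[ℝ] A}

theorem cliffordHom_ext_of_dense [T2Space A]
    (dense : (Submodule.span ℝ (Set.range w)).topologicalClosure = ⊤)
    (hρ : Continuous fun v => ρ (ι Q v)) (hρ' : Continuous fun v => ρ' (ι Q v))
    (h : ∀ i, ρ (ι Q (w i)) = ρ' (ι Q (w i))) : ρ = ρ' := by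
  refine CliffordAlgebra.hom_ext (LinearMap.ext fun v => congrFun (Continuous.ext_on
    (Submodule.dense_iff_topologicalClosure_eq_top.2 dense) hρ hρ' ?_) v)
  exact LinearMap.eqOn_span (f := ρ.toLinearMap ∘ₗ ι Q) (g := ρ'.toLinearMap ∘ₗ ι Q)
    (Set.forall_mem_range.2 h)

theorem cliffordHom_mem_of_dense (dense : (Submodule.span ℝ (Set.range w)).topologicalClosure = ⊤)
    (hρ : Continuous fun v => ρ (ι Q v)) {S : Subalgebra ℝ A} (hS : IsClosed (S : Set A))
    (h : ∀ i, ρ (ι Q (w i)) ∈ S) (a : CliffordAlgebra Q) : ρ a ∈ S := by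
  have mem_ι (v : V) : ρ (ι Q v) ∈ S := by
    have span_le : Submodule.span ℝ (Set.range w) ≤
        (Subalgebra.toSubmodule S).comap (ρ.toLinearMap ∘ₗ ι Q) :=
      Submodule.span_le.2 (Set.range_subset_iff.2 h)
    exact Submodule.topologicalClosure_minimal _ span_le (hS.preimage hρ)
      (dense ▸ Submodule.mem_top : v ∈ (Submodule.span ℝ (Set.range w)).topologicalClosure)
  have adjoin_le : Algebra.adjoin ℝ (Set.range (ι Q)) ≤ S.comap ρ :=
    Algebra.adjoin_le (Set.range_subset_iff.2 mem_ι)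
  exact adjoin_le (CliffordAlgebra.adjoin_range_ι (Q := Q) ▸ Algebra.mem_top)

end Uniqueness

variable {Z κ A : Type*} [NormedAddCommGroup Z] [InnerProductSpace ℝ Z]

theorem negForm_apply (v : Z) : negForm Z v = -‖v‖ ^ 2 := by
  simp [negForm]

theorem mul_self_eq_negForm [Ring A] [Algebra ℝ A] (B : Module.Basis κ ℝ Z) (hB : Orthonormal ℝ B)
    {L : Z →ₗ[ℝ] A} (sq : ∀ i, L (B i) * L (B i) = -1)
    (anticomm : ∀ i j, i ≠ j → L (B i) * L (B j) = -(L (B j) * L (B i))) (v : Z) :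
    L v * L v = algebraMap ℝ A (negForm Z v) := by
  classical
  let mulL : Z →ₗ[ℝ] Z →ₗ[ℝ] A := (LinearMap.mul ℝ A).compl₁₂ L L
  have polar_eq : mulL + mulL.flip = (innerₗ Z).compr₂ ((-2 : ℝ) • Algebra.linearMap ℝ A) := by
    refine LinearMap.ext_basis B B fun i j => ?_
    change L (B i) * L (B j) + L (B j) * L (B i) = (-2 : ℝ) • algebraMap ℝ A (inner ℝ (B i) (B j))
    rw [orthonormal_iff_ite.1 hB]
    split_ifs with hij
    · rw [← hij, sq, map_one, neg_smul, two_smul, neg_add]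
    · rw [anticomm i j hij, neg_add_cancel, map_zero, smul_zero]
  have h : L v * L v + L v * L v = (-2 : ℝ) • algebraMap ℝ A (inner ℝ v v) :=
    LinearMap.congr_fun₂ polar_eq v v
  rw [← two_smul ℝ, neg_smul, ← smul_neg] at h
  rw [smul_right_injective A (two_ne_zero (α := ℝ)) h, negForm_apply, real_inner_self_eq_norm_sq,
    map_neg]

theorem norm_le_of_mul_self_eq_negForm [NormedRing A] [StarRing A] [CStarRing A] [NormedAlgebra ℝ A]
    {a : A} (ha : star a = -a) {v : Z} (sq : a * a = algebraMap ℝ A (negForm Z v)) :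
    ‖a‖ ≤ ‖v‖ := by
  have norm_one_le : ‖(1 : A)‖ ≤ 1 := by
    cases subsingleton_or_nontrivial A
    · simp [Subsingleton.elim (1 : A) 0]
    · exact CStarRing.norm_one.le
  refine (mul_self_le_mul_self_iff (norm_nonneg _) (norm_nonneg _)).2 ?_
  calc ‖a‖ * ‖a‖ = ‖star a * a‖ := CStarRing.norm_star_mul_self.symm
    _ = ‖v‖ ^ 2 * ‖(1 : A)‖ := by
      rw [ha, neg_mul, sq, norm_neg, norm_algebraMap, negForm_apply, norm_neg, norm_pow, norm_norm]
    _ ≤ ‖v‖ * ‖v‖ := by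
      rw [← _root_.sq]; exact mul_le_of_le_one_right (by positivity) norm_one_le

theorem exists_cliffordHom [NormedRing A] [StarRing A] [CStarRing A] [NormedAlgebra ℝ A]
    [StarModule ℝ A] [CompleteSpace A] {w : κ → Z} (orthonormal : Orthonormal ℝ w)
    (dense : (Submodule.span ℝ (Set.range w)).topologicalClosure = ⊤) {J : κ → A}
    (star_eq : ∀ i, star (J i) = -J i) (sq : ∀ i, J i * J i = -1)
    (anticomm : ∀ i j, i ≠ j → J i * J j = -(J j * J i)) :
    ∃ ρ : CliffordAlgebra (negForm Z) →ₐ[ℝ] A,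
      (Continuous fun v => ρ (ι (negForm Z) v)) ∧ ∀ i, ρ (ι (negForm Z) (w i)) = J i := by
  let S := Submodule.span ℝ (Set.range w)
  let B : Module.Basis κ ℝ S := .span orthonormal.linearIndependent
  have coe_B (i) : (B i : Z) = w i :=
    congrArg Subtype.val (Module.Basis.span_apply orthonormal.linearIndependent i)
  have orthonormal_B : Orthonormal ℝ B :=
    S.subtypeₗᵢ.orthonormal_comp_iff.1 (by rwa [show S.subtypeₗᵢ ∘ B = w from funext coe_B])
  let L : S →ₗ[ℝ] A := B.constr ℝ J
  have L_B (i) : L (B i) = J i := B.constr_basis ℝ J i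
  have star_L (v : S) : star (L v) = -L v := by
    have range_le : L.range ≤ skewAdjoint.submodule ℝ A := by
      rw [B.constr_range, Submodule.span_le]
      exact Set.range_subset_iff.2 star_eq
    exact range_le (L.mem_range_self v)
  have sq_L (v : S) : L v * L v = algebraMap ℝ A (negForm S v) :=
    mul_self_eq_negForm B orthonormal_B (by simpa only [L_B] using sq)
      (by simpa only [L_B] using anticomm) v
  let Lc : S →L[ℝ] A := L.mkContinuous 1 fun v => by
    rw [one_mul]; exact norm_le_of_mul_self_eq_negForm (star_L v) (sq_L v)
  have denseRange : DenseRange S.subtypeL := by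
    simpa [DenseRange, Submodule.dense_iff_topologicalClosure_eq_top] using dense
  let K : Z →L[ℝ] A := Lc.extend S.subtypeL
  have K_coe (v : S) : K v = L v :=
    Lc.extend_eq denseRange isUniformEmbedding_subtype_val.isUniformInducing v
  have sq_K (v : Z) : K v * K v = algebraMap ℝ A (negForm Z v) := by
    refine congrFun (denseRange.equalizer (g := fun v => K v * K v)
      (h := fun v => algebraMap ℝ A (negForm Z v)) (by fun_prop) ?_ (funext fun v => ?_)) v
    · simp only [negForm_apply]
      fun_prop
    · exact (congrArg (fun a => a * a) (K_coe v)).trans (sq_L v)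
  refine ⟨CliffordAlgebra.lift _ ⟨K.toLinearMap, sq_K⟩, ?_, fun i => ?_⟩
  · simp only [CliffordAlgebra.lift_ι_apply]
    exact K.continuous
  · rw [CliffordAlgebra.lift_ι_apply, ← coe_B, ← L_B]
    exact K_coe _

end Clifford

section RealForms

variable {H : Type*} [NormedAddCommGroup H] [InnerProductSpace ℂ H]

theorem norm_add_I_smul_eq_norm_sub_iff {f g : H} :
    ‖f + Complex.I • g‖ = ‖f - Complex.I • g‖ ↔ (inner ℂ f g).im = 0 := by
  have re_inner : RCLike.re (inner ℂ f (Complex.I • g)) = -(inner ℂ f g).im := by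
    simp
  rw [← sq_eq_sq₀ (norm_nonneg _) (norm_nonneg _), norm_add_sq (𝕜 := ℂ), norm_sub_sq (𝕜 := ℂ),
    re_inner]
  constructor <;> intro h <;> linarith

/-- The real subspace of the vectors that an antilinear isometry fixes; the real form belonging to
a conjugation. -/
def fixedSubmodule (C : H →ₛₗᵢ[starRingEnd ℂ] H) : Submodule ℝ H where
  carrier := {f | C f = f}
  zero_mem' := map_zero C
  add_mem' {f g} (hf : C f = f) (hg : C g = g) := by
    rw [Set.mem_ofPred_eq, map_add, hf, hg]
  smul_mem' a f (hf : C f = f) := by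
    rw [Set.mem_ofPred_eq, ← Complex.coe_smul, C.map_smulₛₗ, hf, Complex.conj_ofReal]

theorem mem_fixedSubmodule {C : H →ₛₗᵢ[starRingEnd ℂ] H} {f : H} :
    f ∈ fixedSubmodule C ↔ C f = f := Iff.rfl

/-- The real algebra of the bounded operators that commute with an antilinear isometry. -/
def commutant (C : H →ₛₗᵢ[starRingEnd ℂ] H) : Subalgebra ℝ (H →L[ℂ] H) where
  carrier := {T | ∀ f, C (T f) = T (C f)}
  mul_mem' {S T} hS hT f := by
    rw [mul_apply_eq_comp, hS, hT, mul_apply_eq_comp]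
  add_mem' {S T} hS hT f := by
    rw [add_apply, map_add, hS, hT, add_apply]
  algebraMap_mem' r f := by
    change C (r • f) = r • C f
    rw [← Complex.coe_smul, C.map_smulₛₗ, Complex.conj_ofReal, Complex.coe_smul]

theorem isClosed_commutant (C : H →ₛₗᵢ[starRingEnd ℂ] H) :
    IsClosed (commutant C : Set (H →L[ℂ] H)) := by
  have : (commutant C : Set (H →L[ℂ] H)) = ⋂ f, {T | C (T f) = T (C f)} := by
    ext T
    rw [Set.mem_iInter]
    rfl
  rw [this]
  exact isClosed_iInter fun f => isClosed_eq
    (C.continuous.comp (continuous_eval_const f)) (continuous_eval_const _)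

theorem apply_add_I_smul_of_fixed {C : H →ₛₗᵢ[starRingEnd ℂ] H} {f g : H}
    (hf : f ∈ fixedSubmodule C) (hg : g ∈ fixedSubmodule C) :
    C (f + Complex.I • g) = f - Complex.I • g := by
  rw [map_add, C.map_smulₛₗ, hf, hg, Complex.conj_I, neg_smul, sub_eq_add_neg]

theorem existsUnique_add_I_smul {C : H →ₛₗᵢ[starRingEnd ℂ] H} (hC : Function.Involutive C) (h : H) :
    ∃! p : fixedSubmodule C × fixedSubmodule C, h = (p.1 : H) + Complex.I • (p.2 : H) := by
  have average_mem (g : H) : (2⁻¹ : ℂ) • (g + C g) ∈ fixedSubmodule C := by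
    rw [mem_fixedSubmodule, C.map_smulₛₗ, map_add, hC, map_inv₀, Complex.conj_ofNat, add_comm]
  have eq_average (p q : fixedSubmodule C) :
      (p : H) = (2⁻¹ : ℂ) • ((p + Complex.I • (q : H)) + C (p + Complex.I • (q : H))) := by
    rw [apply_add_I_smul_of_fixed p.2 q.2]
    module
  refine ⟨(⟨_, average_mem h⟩, ⟨_, average_mem (-Complex.I • h)⟩), ?_, ?_⟩
  · simp only [C.map_smulₛₗ, map_neg, Complex.conj_I, neg_neg]
    match_scalars
    · linear_combination (1 / 2 : ℂ) * Complex.I_mul_I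
    · linear_combination (-1 / 2 : ℂ) * Complex.I_mul_I
  · rintro ⟨p, q⟩ rfl
    have rotate : -Complex.I • ((p : H) + Complex.I • (q : H)) =
        q + Complex.I • ((-p : fixedSubmodule C) : H) := by
      rw [Submodule.coe_neg]
      match_scalars <;> simp [Complex.I_mul_I]
    refine Prod.ext (Subtype.ext (eq_average p q)) (Subtype.ext ?_)
    rw [rotate]
    exact eq_average q (-p)

theorem exists_conj_of_existsUnique_add {V : Submodule ℝ H}
    (split : ∀ h : H, ∃! p : V × V, h = (p.1 : H) + Complex.I • (p.2 : H))
    (inner_real : ∀ f ∈ V, ∀ g ∈ V, (inner ℂ f g).im = 0) :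
    ∃ C : H →ₛₗᵢ[starRingEnd ℂ] H,
      ∀ f ∈ V, ∀ g ∈ V, C (f + Complex.I • g) = f - Complex.I • g := by
  let plus : V × V →ₗ[ℝ] H := V.subtype.coprod (Complex.I • V.subtype)
  let minus : V × V →ₗ[ℝ] H := V.subtype.coprod (-Complex.I • V.subtype)
  let e : (V × V) ≃ₗ[ℝ] H := .ofBijective plus
    (Function.bijective_iff_existsUnique _ |>.2 fun h => by simpa [plus, eq_comm] using split h)
  have minus_apply (p : V × V) : minus p = p.1 - Complex.I • (p.2 : H) := by
    simp [minus, sub_eq_add_neg]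
  let C : H →ₗ[ℝ] H := minus ∘ₗ e.symm.toLinearMap
  have C_plus (p : V × V) : C (p.1 + Complex.I • (p.2 : H)) = p.1 - Complex.I • (p.2 : H) := by
    rw [← minus_apply]
    exact congrArg minus (e.symm_apply_apply p)
  have C_smul (a : ℂ) (h : H) : C (a • h) = (starRingEnd ℂ) a • C h := by
    obtain ⟨⟨p, q⟩, rfl, -⟩ := split h
    have smul_eq : a • ((p : H) + Complex.I • (q : H)) =
        ((a.re • p - a.im • q : V) : H) + Complex.I • ((a.re • q + a.im • p : V) : H) := by
      simp only [Submodule.coe_add, Submodule.coe_sub, Submodule.coe_smul, ← Complex.coe_smul]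
      match_scalars
      · linear_combination -Complex.re_add_im a
      · linear_combination -Complex.I * Complex.re_add_im a + a.im * Complex.I_mul_I
    have conj_eq : (starRingEnd ℂ) a = a.re - a.im * Complex.I := by
      apply Complex.ext <;> simp
    rw [smul_eq, C_plus (_, _), C_plus (p, q)]
    simp only [Submodule.coe_add, Submodule.coe_sub, Submodule.coe_smul, ← Complex.coe_smul]
    match_scalars
    · linear_combination -conj_eq
    · linear_combination Complex.I * conj_eq - a.im * Complex.I_mul_I
  have norm_C (h : H) : ‖C h‖ = ‖h‖ := by
    obtain ⟨p, rfl, -⟩ := split h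
    rw [C_plus, norm_add_I_smul_eq_norm_sub_iff.2 (inner_real _ p.1.2 _ p.2.2)]
  exact ⟨⟨⟨⟨C, map_add C⟩, C_smul⟩, norm_C⟩, fun f hf g hg => C_plus (⟨f, hf⟩, ⟨g, hg⟩)⟩

variable {Z : Type*} [NormedAddCommGroup Z] [InnerProductSpace ℝ Z]
  {ρ : CliffordAlgebra (negForm Z) →ₐ[ℝ] (H →L[ℂ] H)}

theorem isInvariantRealForm_fixedSubmodule {C : H →ₛₗᵢ[starRingEnd ℂ] H}
    (hC : Function.Involutive C) (hρ : ∀ a, ρ a ∈ commutant C) :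
    IsInvariantRealForm ρ (fixedSubmodule C) where
  invariant a f hf := by rw [mem_fixedSubmodule, hρ, hf]
  existsUnique_add := existsUnique_add_I_smul hC
  inner_real f hf g hg := by
    rw [← norm_add_I_smul_eq_norm_sub_iff, ← C.norm_map, apply_add_I_smul_of_fixed hf hg]

theorem IsInvariantRealForm.exists_conj {V : Submodule ℝ H} (hV : IsInvariantRealForm ρ V) :
    ∃ C : H →ₛₗᵢ[starRingEnd ℂ] H,
      Function.Involutive C ∧ fixedSubmodule C = V ∧ ∀ a, ρ a ∈ commutant C := by
  obtain ⟨C, hC⟩ := exists_conj_of_existsUnique_add hV.existsUnique_add hV.inner_real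
  have C_sub {f g : H} (hf : f ∈ V) (hg : g ∈ V) :
      C (f - Complex.I • g) = f + Complex.I • g := by
    simpa [sub_eq_add_neg] using hC f hf (-g) (V.neg_mem hg)
  refine ⟨C, fun h => ?_, le_antisymm (fun h hh => ?_) fun h hh => ?_, fun a h => ?_⟩
  · obtain ⟨⟨p, q⟩, rfl, -⟩ := hV.existsUnique_add h
    rw [hC p p.2 q q.2, C_sub p.2 q.2]
  · obtain ⟨⟨p, q⟩, rfl, -⟩ := hV.existsUnique_add h
    have I_smul_eq : Complex.I • (q : H) = 0 := by
      rw [mem_fixedSubmodule, hC p p.2 q q.2, sub_eq_add_neg, add_right_inj] at hh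
      have : IsAddTorsionFree H := .of_isTorsionFree ℂ H
      exact neg_eq_self.1 hh
    simp only [I_smul_eq, add_zero, p.2]
  · simpa [mem_fixedSubmodule] using hC h hh 0 V.zero_mem
  · obtain ⟨⟨p, q⟩, rfl, -⟩ := hV.existsUnique_add h
    rw [map_add, map_smul, hC _ (hV.invariant a p p.2) _ (hV.invariant a q q.2), hC p p.2 q q.2,
      map_sub, map_smul]

end RealForms

section Signs

theorem measurable_coordwise (g : ℕ → ZMod 2 → ZMod 2) :
    Measurable fun (x : X) k => g k (x k) :=
  measurable_pi_lambda _ fun k => (measurable_of_countable (g k)).comp (measurable_pi_apply k)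

theorem measurable_add_delta (k : ℕ) : Measurable fun x : X => x + delta k :=
  measurable_coordwise fun j t => t + delta k j

theorem measurable_one_sub : Measurable fun x : X => 1 - x :=
  measurable_coordwise fun _ t => 1 - t

theorem add_delta_add_delta (x : X) (k : ℕ) : x + delta k + delta k = x := by
  have : delta k + delta k = 0 := funext fun j => CharTwo.add_self_eq_zero _
  rw [add_assoc, this, add_zero]

theorem one_sub_add_delta (x : X) (k : ℕ) : 1 - x + delta k = 1 - (x + delta k) := by
  have : -delta k = delta k := funext fun j => CharTwo.neg_eq _
  rw [← sub_sub, sub_eq_add_neg (1 - x), this]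

theorem delta_mem_Delta (k : ℕ) : delta k ∈ Delta :=
  (Set.finite_singleton k).subset fun _ => not_imp_comm.1 fun h => Pi.single_eq_of_ne h _

/-- The sign `(-1) ^ x_k`. -/
def sign (k : ℕ) (x : X) : ℂ := (-1) ^ (x k).val

theorem measurable_sign (k : ℕ) : Measurable (sign k) :=
  (measurable_of_countable fun t : ZMod 2 => (-1 : ℂ) ^ t.val).comp (measurable_pi_apply k)

theorem sign_mul_self (k : ℕ) (x : X) : sign k x * sign k x = 1 := by
  rw [sign, ← pow_add, ← two_mul, pow_mul, neg_one_sq, one_pow]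

theorem sign_eq_neg_of_ne {k : ℕ} {x y : X} (h : x k ≠ y k) : sign k x = -sign k y := by
  have (s t : ZMod 2) (hst : s ≠ t) : (-1 : ℤ) ^ s.val = -(-1) ^ t.val := by
    decide +revert
  simpa [sign] using congrArg (Int.cast : ℤ → ℂ) (this _ _ h)

theorem sign_add_delta_self (k : ℕ) (x : X) : sign k (x + delta k) = -sign k x :=
  sign_eq_neg_of_ne (by simp [delta])

theorem sign_add_delta_of_ne {j k : ℕ} (h : j ≠ k) (x : X) : sign j (x + delta k) = sign j x := by
  simp [sign, delta, Pi.single_eq_of_ne h]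

theorem sign_one_sub (k : ℕ) (x : X) : sign k (1 - x) = -sign k x := by
  have (t : ZMod 2) : 1 - t ≠ t := by decide +revert
  exact sign_eq_neg_of_ne (this (x k))

theorem star_sign (k : ℕ) (x : X) : star (sign k x) = sign k x := by simp [sign]

/-- The sign `(-1) ^ (x_0 + ⋯ + x_{k-1})`. -/
def partialSign (k : ℕ) (x : X) : ℂ := ∏ j ∈ Finset.range k, sign j x

theorem measurable_partialSign (k : ℕ) : Measurable (partialSign k) :=
  Finset.measurable_fun_prod _ fun j _ => measurable_sign j

theorem neg_one_pow_sum_val_add_one (k : ℕ) (x : X) :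
    (-1 : ℂ) ^ ((∑ j ∈ Finset.range k, (x j).val) + 1) = -partialSign k x := by
  simp [partialSign, sign, Finset.prod_pow_eq_pow_sum, pow_succ]

theorem partialSign_mul_self (k : ℕ) (x : X) : partialSign k x * partialSign k x = 1 := by
  rw [partialSign, ← Finset.prod_mul_distrib]
  exact Finset.prod_eq_one fun j _ => sign_mul_self j x

theorem partialSign_add_delta_of_le {k l : ℕ} (h : k ≤ l) (x : X) :
    partialSign k (x + delta l) = partialSign k x :=
  Finset.prod_congr rfl fun _ hj => sign_add_delta_of_ne ((Finset.mem_range.1 hj).trans_le h).ne x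

theorem partialSign_add_delta_of_lt {k l : ℕ} (h : l < k) (x : X) :
    partialSign k (x + delta l) = -partialSign k x := by
  have hl := Finset.mem_range.2 h
  rw [partialSign, partialSign, ← Finset.mul_prod_erase _ _ hl, ← Finset.mul_prod_erase _ _ hl,
    sign_add_delta_self, neg_mul]
  congr 2
  exact Finset.prod_congr rfl fun j hj => sign_add_delta_of_ne (Finset.ne_of_mem_erase hj) x

theorem partialSign_one_sub (k : ℕ) (x : X) :
    partialSign k (1 - x) = (-1) ^ k * partialSign k x := by
  simp [partialSign, sign_one_sub, Finset.prod_neg]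

theorem star_partialSign (k : ℕ) (x : X) : star (partialSign k x) = partialSign k x := by
  simp only [partialSign, star_prod, star_sign]

/-- The index of the coordinate that the operator of the `i`-th basis vector flips, where `inl k`
stands for `z_k` and `inr k` for `σ z_k`. -/
def flipIndex : ℕ ⊕ ℕ → ℕ := Sum.elim id id

/-- The scalar factor in the formula for the operator of the `i`-th basis vector. -/
def phase : ℕ ⊕ ℕ → X → ℂ
  | .inl k, x => -partialSign k x * Complex.I
  | .inr k, x => sign k x * Complex.I * (-partialSign k x * Complex.I)

theorem phase_inr (k : ℕ) (x : X) : phase (.inr k) x = sign k x * partialSign k x := by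
  rw [phase]
  linear_combination (-sign k x * partialSign k x) * Complex.I_mul_I

theorem measurable_phase (i : ℕ ⊕ ℕ) : Measurable (phase i) := by
  rcases i with k | k
  · exact (measurable_partialSign k).neg.mul_const _
  · exact ((measurable_sign k).mul_const _).mul ((measurable_partialSign k).neg.mul_const _)

theorem phase_mul_phase_add_delta_self (i : ℕ ⊕ ℕ) (x : X) :
    phase i x * phase i (x + delta (flipIndex i)) = -1 := by
  rcases i with k | k <;> simp only [flipIndex, Sum.elim_inl, Sum.elim_inr, id]
  · rw [phase, phase, partialSign_add_delta_of_le le_rfl]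
    linear_combination (partialSign k x * partialSign k x) * Complex.I_mul_I -
      partialSign_mul_self k x
  · rw [phase_inr, phase_inr, partialSign_add_delta_of_le le_rfl, sign_add_delta_self]
    linear_combination -partialSign k x * partialSign k x * sign_mul_self k x -
      partialSign_mul_self k x

theorem star_phase_one_sub (i : ℕ ⊕ ℕ) (x : X) :
    star (phase i (1 - x)) = (-1) ^ (flipIndex i + 1) * phase i x := by
  rcases i with k | k
  · simp [phase, partialSign_one_sub, star_partialSign, flipIndex, pow_succ, mul_assoc]
  · simp [phase_inr, partialSign_one_sub, star_partialSign, sign_one_sub, star_sign, flipIndex,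
      pow_succ]
    ring

theorem phase_ne_zero (i : ℕ ⊕ ℕ) (x : X) : phase i x ≠ 0 := fun h => by
  simpa [h] using phase_mul_phase_add_delta_self i x

theorem norm_phase (i : ℕ ⊕ ℕ) (x : X) : ‖phase i x‖ = 1 := by
  rcases i with k | k <;> simp [phase, partialSign, sign]

theorem phase_anticomm {i j : ℕ ⊕ ℕ} (h : i ≠ j) (x : X) :
    phase i x * phase j (x + delta (flipIndex i)) =
      -(phase j x * phase i (x + delta (flipIndex j))) := by
  rcases i with k | k <;> rcases j with l | l <;>
    simp only [phase, flipIndex, Sum.elim_inl, Sum.elim_inr, id, ne_eq, Sum.inl.injEq,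
      Sum.inr.injEq] at h ⊢ <;>
    rcases lt_trichotomy k l with hkl | rfl | hkl <;>
    first
    | exact absurd rfl h
    | (simp only [partialSign_add_delta_of_le le_rfl, sign_add_delta_self]
       ring)
    | (simp only [partialSign_add_delta_of_le hkl.le, partialSign_add_delta_of_lt hkl,
        sign_add_delta_of_ne hkl.ne, sign_add_delta_of_ne hkl.ne']
       ring)

end Signs

theorem star_eq_neg_of_mul_self_eq_neg_one {A : Type*} [Ring A] [Star A] {a : A}
    (h : star a * a = 1) (h' : a * a = -1) : star a = -a :=
  calc star a = -(star a * (a * a)) := by rw [h', mul_neg_one, neg_neg]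
    _ = -a := by rw [← mul_assoc, h, one_mul]

theorem IsUnitaryOn.apply_mem {F : Submodule ℂ E} {A : E →L[ℂ] E} (h : IsUnitaryOn F A) {v : E}
    (hv : v ∈ F) : A v ∈ F :=
  h.map_eq.le (Submodule.mem_map_of_mem (f := (A : E →ₗ[ℂ] E)) hv)

/-- The real orthonormal basis of a frame: `inl k` stands for `z_k` and `inr k` for `σ z_k`. -/
def Frame.vec {Z : Type*} [NormedAddCommGroup Z] [InnerProductSpace ℝ Z] (b : Frame Z) :
    ℕ ⊕ ℕ → Z := Sum.elim b.z fun k => b.σ (b.z k)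

namespace Triple

section Space

instance (D : Triple) : SigmaFinite D.μ := D.sigmaFinite

instance (D : Triple) : CoeFun D.space fun _ => X → E := ⟨fun f => (f : Lp E 2 D.μ)⟩

variable {D : Triple}

theorem apply_mem_fiber (f : D.space) : ∀ᵐ x ∂D.μ, f x ∈ fiber (D.ν x) := f.2

theorem space_ext {f g : D.space} (h : ∀ᵐ x ∂D.μ, f x = g x) : f = g := Subtype.ext (Lp.ext h)

theorem exists_space {F : X → E} (hF : MemLp F 2 D.μ) (hν : ∀ᵐ x ∂D.μ, F x ∈ fiber (D.ν x)) :
    ∃ f : D.space, ∀ᵐ x ∂D.μ, f x = F x := by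
  refine ⟨⟨hF.toLp F, ?_⟩, hF.coeFn_toLp⟩
  filter_upwards [hν, hF.coeFn_toLp] with x hx hFx
  rwa [hFx]

theorem coeFn_add (f g : D.space) : ∀ᵐ x ∂D.μ, (f + g) x = f x + g x :=
  Lp.coeFn_add (f : Lp E 2 D.μ) g

theorem coeFn_sub (f g : D.space) : ∀ᵐ x ∂D.μ, (f - g) x = f x - g x :=
  Lp.coeFn_sub (f : Lp E 2 D.μ) g

theorem coeFn_neg (f : D.space) : ∀ᵐ x ∂D.μ, (-f) x = -f x := Lp.coeFn_neg (f : Lp E 2 D.μ)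

theorem coeFn_smul (a : ℂ) (f : D.space) : ∀ᵐ x ∂D.μ, (a • f) x = a • f x :=
  Lp.coeFn_smul a (f : Lp E 2 D.μ)

theorem aestronglyMeasurable_coe (f : D.space) : AEStronglyMeasurable f D.μ :=
  Lp.aestronglyMeasurable (f : Lp E 2 D.μ)

theorem norm_space (f : D.space) : ‖f‖ = (eLpNorm f 2 D.μ).toReal := Lp.norm_def (f : Lp E 2 D.μ)

instance : CompleteSpace D.space := by
  suffices IsClosed (D.space : Set (Lp E 2 D.μ)) from this.completeSpace_coe
  refine isClosed_of_closure_subset fun f hf => ?_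
  obtain ⟨u, hu, hlim⟩ := mem_closure_iff_seq_limit.1 hf
  obtain ⟨ns, -, hns⟩ := (tendstoInMeasure_of_tendsto_Lp hlim).exists_seq_tendsto_ae
  have mem_fiber_u : ∀ᵐ x ∂D.μ, ∀ n, u n x ∈ fiber (D.ν x) := ae_all_iff.2 hu
  filter_upwards [hns, mem_fiber_u] with x hx hux
  exact (isClosed_fiber _).mem_of_tendsto hx (.of_forall fun n => hux _)

theorem exists_weightedComp {σ : ℂ →+* ℂ} [RingHomIsometric σ] {φ : X → X}
    (hφ : QuasiInvolution φ D.μ) {A : X → E →SL[σ] E}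
    (measurable_A : ∀ i, AEStronglyMeasurable (fun x => A x (stdBasis i)) D.μ)
    (mapsTo : ∀ᵐ x ∂D.μ, ∀ v ∈ fiber (D.ν (φ x)), A x v ∈ fiber (D.ν x))
    (norm_A : ∀ᵐ x ∂D.μ, ∀ v ∈ fiber (D.ν (φ x)), ‖A x v‖ = ‖v‖) :
    ∃ T : D.space →ₛₗᵢ[σ] D.space, ∀ f : D.space, ∀ᵐ x ∂D.μ,
      T f x = ((sqrtDensity D.μ φ x : ℝ) : ℂ) • A x (f (φ x)) := by
  let F (f : D.space) (x : X) : E := ((sqrtDensity D.μ φ x : ℝ) : ℂ) • A x (f (φ x))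
  have eLpNorm_F (f : D.space) : eLpNorm (F f) 2 D.μ = eLpNorm f 2 D.μ := by
    refine hφ.eLpNorm_eq (aestronglyMeasurable_coe f) ?_
    filter_upwards [norm_A, hφ.ae (apply_mem_fiber f)] with x hx hfx
    rw [norm_smul, hx _ hfx, Complex.norm_real, Real.norm_of_nonneg (sqrtDensity_nonneg _ _)]
  have memLp_F (f : D.space) : MemLp (F f) 2 D.μ := by
    refine ⟨?_, (eLpNorm_F f).trans_lt (Lp.eLpNorm_lt_top (f : Lp E 2 D.μ))⟩
    exact (Complex.measurable_ofReal.comp (measurable_sqrtDensity φ)).aestronglyMeasurable.smul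
      (aestronglyMeasurable_apply stdBasis measurable_A
        ((aestronglyMeasurable_coe f).comp_quasiMeasurePreserving hφ.toQuasiMeasurePreserving))
  have mem_fiber_F (f : D.space) : ∀ᵐ x ∂D.μ, F f x ∈ fiber (D.ν x) := by
    filter_upwards [mapsTo, hφ.ae (apply_mem_fiber f)] with x hx hfx
    exact Submodule.smul_mem _ _ (hx _ hfx)
  choose T hT using fun f => exists_space (memLp_F f) (mem_fiber_F f)
  refine ⟨⟨⟨⟨T, fun f g => space_ext ?_⟩, fun a f => space_ext ?_⟩, fun f => ?_⟩, hT⟩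
  · filter_upwards [hT f, hT g, hT (f + g), coeFn_add (T f) (T g), hφ.ae (coeFn_add f g)]
      with x hf hg hfg hadd hadd'
    simp only [hfg, hadd, hf, hg, F, hadd', map_add, smul_add]
  · filter_upwards [hT f, hT (a • f), coeFn_smul (σ a) (T f), hφ.ae (coeFn_smul a f)]
      with x hf haf hsmul hsmul'
    simp only [haf, hsmul, hf, F, hsmul', map_smulₛₗ, smul_comm (σ a)]
  · change ‖T f‖ = ‖f‖
    rw [norm_space, norm_space, eLpNorm_congr_ae (hT f), eLpNorm_F]

end Space

section BasisOp

variable (D : Triple)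

theorem quasiInvolution_add_delta (k : ℕ) : QuasiInvolution (fun x => x + delta k) D.μ :=
  ⟨⟨measurable_add_delta k, (D.quasiInvariant _ (delta_mem_Delta k)).1⟩,
    fun x => add_delta_add_delta x k⟩

theorem exists_basisOp (i : ℕ ⊕ ℕ) :
    ∃ T : D.space →ₗᵢ[ℂ] D.space, ∀ f : D.space, ∀ᵐ x ∂D.μ,
      T f x = ((sqrtDensity D.μ (fun y => y + delta (flipIndex i)) x : ℝ) : ℂ) •
        (phase i x • D.c (flipIndex i) x) (f (x + delta (flipIndex i))) := by
  refine exists_weightedComp (D.quasiInvolution_add_delta _)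
    (fun j => (measurable_phase i).aestronglyMeasurable.smul (D.measurable_c _ _)) ?_ ?_ <;>
  filter_upwards [D.unitary_c (flipIndex i), D.ν_add _ (delta_mem_Delta (flipIndex i))]
    with x hc hν v hv <;>
  rw [hν] at hv
  · exact Submodule.smul_mem _ _ (hc.apply_mem hv)
  · rw [smul_apply, norm_smul, norm_phase, one_mul, hc.norm_map v hv]

/-- The operator on the direct integral that represents the `i`-th basis vector. -/
def basisOp (i : ℕ ⊕ ℕ) : D.space →ₗᵢ[ℂ] D.space := (D.exists_basisOp i).choose

variable {D}

theorem basisOp_apply (i : ℕ ⊕ ℕ) (f : D.space) : ∀ᵐ x ∂D.μ, D.basisOp i f x =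
    ((sqrtDensity D.μ (fun y => y + delta (flipIndex i)) x : ℝ) : ℂ) • phase i x •
      D.c (flipIndex i) x (f (x + delta (flipIndex i))) :=
  (D.exists_basisOp i).choose_spec f

theorem basisOp_basisOp_apply (i j : ℕ ⊕ ℕ) (f : D.space) :
    ∀ᵐ x ∂D.μ, D.basisOp i (D.basisOp j f) x =
      ((sqrtDensity D.μ (fun y => y + delta (flipIndex i)) x *
        sqrtDensity D.μ (fun y => y + delta (flipIndex j)) (x + delta (flipIndex i)) : ℝ) : ℂ) •
      (phase i x * phase j (x + delta (flipIndex i))) •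
      (D.c (flipIndex i) x ∘L D.c (flipIndex j) (x + delta (flipIndex i)))
        (f (x + delta (flipIndex i) + delta (flipIndex j))) := by
  filter_upwards [basisOp_apply i (D.basisOp j f),
    (D.quasiInvolution_add_delta (flipIndex i)).ae (basisOp_apply j f)] with x hi hj
  rw [hi, hj]
  simp only [map_smul, ContinuousLinearMap.comp_apply, Complex.ofReal_mul]
  module

theorem c_apply_c_add_delta (k : ℕ) :
    ∀ᵐ x ∂D.μ, ∀ v ∈ fiber (D.ν x), D.c k x (D.c k (x + delta k) v) = v := by
  filter_upwards [D.adjoint_c k, D.unitary_c k, (D.quasiInvolution_add_delta k).ae (D.unitary_c k),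
    D.ν_add _ (delta_mem_Delta k)] with x adjoint_eq unitary unitary' hν v hv
  rw [hν] at unitary'
  have hcv : D.c k (x + delta k) v ∈ fiber (D.ν x) := unitary'.apply_mem hv
  rw [← sub_eq_zero, ← norm_eq_zero, ← sq_eq_zero_iff, norm_sub_sq (𝕜 := ℂ), unitary.norm_map _ hcv,
    unitary'.norm_map _ hv, ← ContinuousLinearMap.adjoint_inner_right, adjoint_eq,
    inner_self_eq_norm_sq, unitary'.norm_map _ hv]
  ring

theorem basisOp_basisOp_self (i : ℕ ⊕ ℕ) (f : D.space) : D.basisOp i (D.basisOp i f) = -f := by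
  refine space_ext ?_
  filter_upwards [basisOp_basisOp_apply i i f, coeFn_neg f, apply_mem_fiber f,
    c_apply_c_add_delta (flipIndex i),
    (D.quasiInvolution_add_delta (flipIndex i)).sqrtDensity_mul_self] with x hJJ hneg hf hc hw
  rw [hJJ, hneg, phase_mul_phase_add_delta_self, hw, ContinuousLinearMap.comp_apply,
    add_delta_add_delta, hc _ hf, Complex.ofReal_one, one_smul, neg_one_smul]

theorem basisOp_anticomm {i j : ℕ ⊕ ℕ} (hij : i ≠ j) (f : D.space) :
    D.basisOp i (D.basisOp j f) = -D.basisOp j (D.basisOp i f) := by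
  refine space_ext ?_
  filter_upwards [basisOp_basisOp_apply i j f, basisOp_basisOp_apply j i f,
    coeFn_neg (D.basisOp j (D.basisOp i f)), D.comm_c (flipIndex i) (flipIndex j),
    (D.quasiInvolution_add_delta (flipIndex i)).sqrtDensity_mul_comm
      (D.quasiInvolution_add_delta (flipIndex j)) (funext fun x => add_right_comm _ _ _)]
    with x hij_apply hji_apply hneg hc hw
  rw [hneg, hij_apply, hji_apply, phase_anticomm hij, hc, hw, add_right_comm x, neg_smul, smul_neg]

theorem star_basisOp (i : ℕ ⊕ ℕ) : star (D.basisOp i).toContinuousLinearMap =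
    -(D.basisOp i).toContinuousLinearMap :=
  star_eq_neg_of_mul_self_eq_neg_one
    ((ContinuousLinearMap.norm_map_iff_adjoint_comp_self _).1 (D.basisOp i).norm_map)
    (ContinuousLinearMap.ext (basisOp_basisOp_self i))

end BasisOp

section Representation

variable {Z : Type*} [NormedAddCommGroup Z] [InnerProductSpace ℝ Z]

variable {D : Triple} {b : Frame Z}
  {ρ : CliffordAlgebra (negForm Z) →ₐ[ℝ] (D.space →L[ℂ] D.space)}

theorem isRep_iff : D.IsRep b ρ ↔
    (Continuous fun v : Z => ρ (CliffordAlgebra.ι (negForm Z) v)) ∧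
      ∀ i, ρ (CliffordAlgebra.ι (negForm Z) (b.vec i)) = (D.basisOp i).toContinuousLinearMap := by
  have basisOp_inl (k : ℕ) (f : D.space) : ∀ᵐ x ∂D.μ, D.basisOp (.inl k) f x =
      ((-1 : ℂ) ^ ((∑ j ∈ Finset.range k, (x j).val) + 1) * Complex.I) •
        D.c k x (((√(D.shiftDensity k x) : ℝ) : ℂ) • f (x + delta k)) := by
    filter_upwards [basisOp_apply (.inl k) f] with x hx
    rw [hx, neg_one_pow_sum_val_add_one, map_smul, smul_comm]
    rfl
  have basisOp_inr (k : ℕ) (f : D.space) : ∀ᵐ x ∂D.μ, D.basisOp (.inr k) f x =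
      ((-1 : ℂ) ^ (x k).val * Complex.I) • D.basisOp (.inl k) f x := by
    filter_upwards [basisOp_apply (.inl k) f, basisOp_apply (.inr k) f] with x hl hr
    rw [hl, hr, smul_comm ((-1 : ℂ) ^ (x k).val * Complex.I), smul_smul ((-1 : ℂ) ^ _ * _)]
    rfl
  constructor
  · refine fun h => ⟨h.continuous, ?_⟩
    have eq_inl (k : ℕ) (f : D.space) :
        ρ (CliffordAlgebra.ι (negForm Z) (b.z k)) f = D.basisOp (.inl k) f := by
      refine space_ext ?_
      filter_upwards [h.apply_z k f, basisOp_inl k f] with x hρ hJ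
      rw [hρ, hJ]
    rintro (k | k) <;> ext1 f
    · exact eq_inl k f
    · refine space_ext ?_
      filter_upwards [h.apply_σz k f, basisOp_inr k f] with x hρ hJ
      exact hρ.trans (by rw [eq_inl]; exact hJ.symm)
  · rintro ⟨hc, h⟩
    have eq_inl (k : ℕ) : ρ (CliffordAlgebra.ι (negForm Z) (b.z k)) =
        (D.basisOp (.inl k)).toContinuousLinearMap := h (.inl k)
    have eq_inr (k : ℕ) : ρ (CliffordAlgebra.ι (negForm Z) (b.σ (b.z k))) =
        (D.basisOp (.inr k)).toContinuousLinearMap := h (.inr k)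
    refine ⟨hc, fun k f => ?_, fun k f => ?_⟩
    · rw [eq_inl]
      exact basisOp_inl k f
    · rw [eq_inl, eq_inr]
      exact basisOp_inr k f

theorem existsUnique_isRep (D : Triple) (b : Frame Z) : ∃! ρ, D.IsRep b ρ := by
  obtain ⟨ρ, continuous_ρ, hρ⟩ := exists_cliffordHom b.orthonormal b.dense (star_basisOp (D := D))
    (fun i => ContinuousLinearMap.ext (basisOp_basisOp_self i))
    (fun i j hij => ContinuousLinearMap.ext (basisOp_anticomm hij))
  refine ⟨ρ, isRep_iff.2 ⟨continuous_ρ, hρ⟩, fun ρ' h' => ?_⟩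
  obtain ⟨continuous_ρ', hρ'⟩ := isRep_iff.1 h'
  exact cliffordHom_ext_of_dense b.dense continuous_ρ' continuous_ρ fun i =>
    (hρ' i).trans (hρ i).symm

theorem IsRep.forall_mem_iff (h : D.IsRep b ρ) {S : Subalgebra ℝ (D.space →L[ℂ] D.space)}
    (hS : IsClosed (S : Set (D.space →L[ℂ] D.space))) :
    (∀ a, ρ a ∈ S) ↔ ∀ i, (D.basisOp i).toContinuousLinearMap ∈ S := by
  obtain ⟨continuous_ρ, hρ⟩ := isRep_iff.1 h
  refine ⟨fun hS i => hρ i ▸ hS _, fun hJ => ?_⟩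
  exact cliffordHom_mem_of_dense b.dense continuous_ρ hS fun i => (hρ i).symm ▸ hJ i

end Representation

end Triple

/-- The coordinatewise conjugation of `ℓ²(ℕ, ℂ)`, as an antilinear operator. -/
def starOp : E →L⋆[ℂ] E := (starL ℂ : E ≃L⋆[ℂ] E)

theorem starOp_apply (v : E) : starOp v = star v := rfl

namespace Triple

section Frame

variable (D : Triple)

theorem exists_cutoff : ∃ g : X → NNReal, (∀ x, 0 < g x) ∧ Measurable g ∧
    ∫⁻ x, g x ∂D.μ < 1 :=
  exists_pos_lintegral_lt_of_sigmaFinite D.μ one_ne_zero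

/-- A positive square-integrable function on the base. -/
def cutoff (x : X) : ℝ := √(D.exists_cutoff.choose x)

theorem cutoff_pos (x : X) : 0 < D.cutoff x :=
  Real.sqrt_pos.2 (D.exists_cutoff.choose_spec.1 x)

theorem measurable_cutoff : Measurable D.cutoff :=
  (measurable_coe_nnreal_real.comp D.exists_cutoff.choose_spec.2.1).sqrt

theorem ofReal_cutoff_ne_zero (x : X) : (D.cutoff x : ℂ) ≠ 0 :=
  Complex.ofReal_ne_zero.2 (D.cutoff_pos x).ne'

theorem memLp_cutoff : MemLp D.cutoff 2 D.μ := by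
  refine ⟨D.measurable_cutoff.aestronglyMeasurable, ?_⟩
  rw [eLpNorm_lt_top_iff_lintegral_rpow_enorm_lt_top two_ne_zero ENNReal.ofNat_ne_top]
  refine lt_of_eq_of_lt (lintegral_congr fun x => ?_)
    (D.exists_cutoff.choose_spec.2.2.trans ENNReal.one_lt_top)
  rw [ENNReal.toReal_ofNat, ENNReal.rpow_ofNat, Real.enorm_of_nonneg (D.cutoff_pos x).le,
    ← ENNReal.ofReal_pow (D.cutoff_pos x).le, cutoff, Real.sq_sqrt (NNReal.coe_nonneg _),
    ENNReal.ofReal_coe_nnreal]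

theorem measurableSet_lt_ν (i : ℕ) : MeasurableSet {x | (i : ℕ∞) < D.ν x} :=
  D.measurable_ν (Set.Ioi (i : ℕ∞)).to_countable.measurableSet

theorem exists_frame (i : ℕ) : ∃ u : D.space, ∀ᵐ x ∂D.μ,
    u x = if (i : ℕ∞) < D.ν x then (D.cutoff x : ℂ) • stdBasis i else 0 := by
  have aestronglyMeasurable : AEStronglyMeasurable
      (fun x => if (i : ℕ∞) < D.ν x then (D.cutoff x : ℂ) • stdBasis i else 0) D.μ :=
    (StronglyMeasurable.ite (D.measurableSet_lt_ν i)
      ((Complex.measurable_ofReal.comp D.measurable_cutoff).stronglyMeasurable.smul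
        stronglyMeasurable_const) stronglyMeasurable_const).aestronglyMeasurable
  refine exists_space (D.memLp_cutoff.of_le aestronglyMeasurable (.of_forall fun x => ?_))
    (.of_forall fun x => ?_) <;> split_ifs with hi
  · rw [norm_smul, stdBasis.orthonormal.1, mul_one, Complex.norm_real]
  · rw [norm_zero]
    exact norm_nonneg _
  · exact Submodule.smul_mem _ _ (stdBasis_mem_fiber hi)
  · exact Submodule.zero_mem _

/-- The `i`-th standard basis vector in the fibres of dimension greater than `i`, scaled by a
positive function that makes it square-integrable. -/
def frame (i : ℕ) : D.space := (D.exists_frame i).choose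

variable {D}

theorem frame_apply : ∀ᵐ x ∂D.μ, ∀ i, D.frame i x =
    if (i : ℕ∞) < D.ν x then (D.cutoff x : ℂ) • stdBasis i else 0 :=
  ae_all_iff.2 fun i => (D.exists_frame i).choose_spec

theorem ae_apply_stdBasis_eq {σ : ℂ →+* ℂ} {φ : X → X}
    (hφ : Measure.QuasiMeasurePreserving φ D.μ D.μ) {A B : X → E →SL[σ] E}
    (h : ∀ f : D.space, ∀ᵐ x ∂D.μ, A x (f (φ x)) = B x (f (φ x))) :
    ∀ᵐ x ∂D.μ, ∀ i : ℕ, (i : ℕ∞) < D.ν (φ x) → A x (stdBasis i) = B x (stdBasis i) := by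
  filter_upwards [ae_all_iff.2 fun i => h (D.frame i), hφ.ae frame_apply] with x hAB hframe i hi
  have := hAB i
  rw [hframe, if_pos hi, map_smulₛₗ, map_smulₛₗ] at this
  exact smul_right_injective _ ((map_ne_zero σ).2 (D.ofReal_cutoff_ne_zero _)) this

end Frame

section ReflConj

/-- The part of the standard type that concerns only the base and the dimensions: it makes the
standard conjugation of the direct integral well defined. -/
structure IsReflInvariant (D : Triple) : Prop where
  quasiInvolution : QuasiInvolution (fun x : X => 1 - x) D.μ
  ν_one_sub : ∀ᵐ x ∂D.μ, D.ν (1 - x) = D.ν x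

variable {D : Triple}

theorem IsStandard.isReflInvariant (h : D.IsStandard) : D.IsReflInvariant :=
  ⟨⟨h.quasi, sub_sub_cancel 1⟩, h.ν_refl⟩

namespace IsReflInvariant

theorem exists_reflConj (h : D.IsReflInvariant) :
    ∃ T : D.space →ₛₗᵢ[starRingEnd ℂ] D.space, ∀ f : D.space, ∀ᵐ x ∂D.μ,
      T f x = ((sqrtDensity D.μ (fun y => 1 - y) x : ℝ) : ℂ) • starOp (f (1 - x)) := by
  refine exists_weightedComp h.quasiInvolution (A := fun _ => starOp)
    (fun _ => aestronglyMeasurable_const) ?_ (.of_forall fun _ v _ => norm_star v)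
  filter_upwards [h.ν_one_sub] with x hν v hv
  rw [hν] at hv
  exact star_mem_fiber hv

/-- The conjugation `f ↦ √(dμ(1 - x)/dμ(x)) conj (f(1 - x))`. -/
def reflConj (h : D.IsReflInvariant) : D.space →ₛₗᵢ[starRingEnd ℂ] D.space :=
  h.exists_reflConj.choose

theorem reflConj_apply (h : D.IsReflInvariant) (f : D.space) : ∀ᵐ x ∂D.μ, h.reflConj f x =
    ((sqrtDensity D.μ (fun y => 1 - y) x : ℝ) : ℂ) • star (f (1 - x)) :=
  h.exists_reflConj.choose_spec f

theorem involutive_reflConj (h : D.IsReflInvariant) : Function.Involutive h.reflConj := by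
  refine fun f => space_ext ?_
  filter_upwards [h.reflConj_apply (h.reflConj f), h.quasiInvolution.ae (h.reflConj_apply f),
    h.quasiInvolution.sqrtDensity_mul_self] with x hRR hR hw
  rw [hRR, hR, star_smul, star_star, sub_sub_cancel, smul_smul, Complex.star_def,
    Complex.conj_ofReal, ← Complex.ofReal_mul, hw, Complex.ofReal_one, one_smul]

theorem reflConj_basisOp_apply (h : D.IsReflInvariant) (i : ℕ ⊕ ℕ) (f : D.space) :
    ∀ᵐ x ∂D.μ, h.reflConj (D.basisOp i f) x =
      (((sqrtDensity D.μ (fun y => 1 - y) x *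
        sqrtDensity D.μ (fun y => y + delta (flipIndex i)) (1 - x) : ℝ) : ℂ) * phase i x) •
      (-1 : ℂ) ^ (flipIndex i + 1) •
        star (D.c (flipIndex i) (1 - x) (f (1 - x + delta (flipIndex i)))) := by
  filter_upwards [h.reflConj_apply (D.basisOp i f), h.quasiInvolution.ae (basisOp_apply i f)]
    with x hR hJ
  rw [hR, hJ, star_smul, star_smul, star_phase_one_sub, Complex.star_def, Complex.conj_ofReal,
    Complex.ofReal_mul]
  module

theorem basisOp_reflConj_apply (h : D.IsReflInvariant) (i : ℕ ⊕ ℕ) (f : D.space) :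
    ∀ᵐ x ∂D.μ, D.basisOp i (h.reflConj f) x =
      (((sqrtDensity D.μ (fun y => y + delta (flipIndex i)) x *
        sqrtDensity D.μ (fun y => 1 - y) (x + delta (flipIndex i)) : ℝ) : ℂ) * phase i x) •
      D.c (flipIndex i) x (star (f (1 - x + delta (flipIndex i)))) := by
  filter_upwards [basisOp_apply i (h.reflConj f),
    (D.quasiInvolution_add_delta (flipIndex i)).ae (h.reflConj_apply f)] with x hJ hR
  rw [hJ, hR, one_sub_add_delta, map_smul, Complex.ofReal_mul]
  module

theorem reflConj_basisOp_eq_iff (h : D.IsReflInvariant) (i : ℕ ⊕ ℕ) (f : D.space) :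
    h.reflConj (D.basisOp i f) = D.basisOp i (h.reflConj f) ↔
      ∀ᵐ x ∂D.μ, star (D.c (flipIndex i) (1 - x) (f (1 - x + delta (flipIndex i)))) =
        (-1 : ℂ) ^ (flipIndex i + 1) •
          D.c (flipIndex i) x (star (f (1 - x + delta (flipIndex i)))) := by
  have hδ := D.quasiInvolution_add_delta (flipIndex i)
  have sign_mul_self : (-1 : ℂ) ^ (flipIndex i + 1) * (-1) ^ (flipIndex i + 1) = 1 := by
    rw [← mul_pow, neg_one_mul, neg_neg, one_pow]
  have pointwise : ∀ᵐ x ∂D.μ, (h.reflConj (D.basisOp i f) x = D.basisOp i (h.reflConj f) x ↔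
      star (D.c (flipIndex i) (1 - x) (f (1 - x + delta (flipIndex i)))) =
        (-1 : ℂ) ^ (flipIndex i + 1) •
          D.c (flipIndex i) x (star (f (1 - x + delta (flipIndex i))))) := by
    filter_upwards [h.reflConj_basisOp_apply i f, h.basisOp_reflConj_apply i f,
      h.quasiInvolution.sqrtDensity_mul_comm hδ (funext fun x => (one_sub_add_delta x _).symm),
      hδ.sqrtDensity_pos, hδ.ae h.quasiInvolution.sqrtDensity_pos] with x hRJ hJR hcomm hs hr
    rw [hRJ, hJR, hcomm, smul_right_inj (mul_ne_zero
      (Complex.ofReal_ne_zero.2 (mul_pos hs hr).ne') (phase_ne_zero i x))]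
    constructor <;> intro h
    · rw [← h, smul_smul, sign_mul_self, one_smul]
    · rw [h, smul_smul, sign_mul_self, one_smul]
  refine ⟨fun h => ?_, fun h => space_ext ?_⟩
  · filter_upwards [pointwise] with x hx
    rw [← hx, h]
  · filter_upwards [pointwise, h] with x hx h
    rwa [hx]

theorem isStandard_iff (h : D.IsReflInvariant) :
    D.IsStandard ↔ ∀ i, (D.basisOp i).toContinuousLinearMap ∈ commutant h.reflConj := by
  constructor
  · intro hD i f
    refine (h.reflConj_basisOp_eq_iff i f).2 ?_
    filter_upwards [hD.c_refl (flipIndex i)] with x hc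
    rw [← hc, star_star]
  · intro hJ
    refine ⟨h.quasiInvolution.absolutelyContinuous, h.quasiInvolution.absolutelyContinuous_map,
      h.ν_one_sub, fun k => ?_⟩
    have hφ : Measure.QuasiMeasurePreserving (fun x : X => 1 - x + delta k) D.μ D.μ :=
      (D.quasiInvolution_add_delta k).toQuasiMeasurePreserving.comp
        h.quasiInvolution.toQuasiMeasurePreserving
    have on_fiber := ae_apply_stdBasis_eq hφ (A := fun x => starOp.comp (D.c k (1 - x)))
      (B := fun x => (-1 : ℂ) ^ (k + 1) • (D.c k x).comp starOp)
      fun f => (h.reflConj_basisOp_eq_iff (.inl k) f).1 (hJ (.inl k) f)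
    filter_upwards [on_fiber, D.unitary_c k, h.quasiInvolution.ae (D.unitary_c k), h.ν_one_sub,
      h.quasiInvolution.ae (D.ν_add _ (delta_mem_Delta k))] with x on_fiber hc hc' hν hν'
    rw [hν', hν] at on_fiber
    rw [hν] at hc'
    suffices starOp.comp (D.c k (1 - x)) = (-1 : ℂ) ^ (k + 1) • (D.c k x).comp starOp by
      intro v
      simpa [starOp_apply] using DFunLike.congr_fun this (star v)
    refine ext_stdBasis fun i => ?_
    rcases lt_or_ge (i : ℕ∞) (D.ν x) with hi | hi
    · exact on_fiber i hi
    · have mem_orthogonal := stdBasis_mem_fiber_orthogonal hi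
      simp [starOp_apply, star_stdBasis, hc.map_orthogonal _ mem_orthogonal,
        hc'.map_orthogonal _ mem_orthogonal]

end IsReflInvariant

theorem IsStandard.mem_realForm_iff (h : D.IsStandard) {f : D.space} :
    f ∈ h.realForm ↔ h.isReflInvariant.reflConj f = f := by
  have reflConj_apply : ∀ᵐ x ∂D.μ, h.isReflInvariant.reflConj f x =
      star (((√(D.reflDensity x) : ℝ) : ℂ) • f (1 - x)) := by
    filter_upwards [h.isReflInvariant.reflConj_apply f] with x hx
    rw [hx, star_smul, Complex.star_def, Complex.conj_ofReal]
    rfl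
  constructor
  · refine fun (hf : ∀ᵐ x ∂D.μ, star (f x) = ((√(D.reflDensity x) : ℝ) : ℂ) • f (1 - x)) =>
      space_ext ?_
    filter_upwards [reflConj_apply, hf] with x hR hfx
    rw [hR, ← hfx, star_star]
  · intro hf
    change ∀ᵐ x ∂D.μ, star (f x) = ((√(D.reflDensity x) : ℝ) : ℂ) • f (1 - x)
    filter_upwards [reflConj_apply] with x hR
    rw [hf] at hR
    rw [hR, star_star]

theorem IsStandard.realForm_eq (h : D.IsStandard) :
    h.realForm = fixedSubmodule h.isReflInvariant.reflConj :=
  Submodule.ext fun _ => h.mem_realForm_iff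

variable {Z : Type*} [NormedAddCommGroup Z] [InnerProductSpace ℝ Z] {b : Frame Z}
  {ρ : CliffordAlgebra (negForm Z) →ₐ[ℝ] (D.space →L[ℂ] D.space)}

theorem IsStandard.isInvariantRealForm (h : D.IsStandard) (hρ : D.IsRep b ρ) :
    IsInvariantRealForm ρ h.realForm := by
  rw [h.realForm_eq]
  exact isInvariantRealForm_fixedSubmodule h.isReflInvariant.involutive_reflConj
    ((hρ.forall_mem_iff (isClosed_commutant _)).2 (h.isReflInvariant.isStandard_iff.1 h))

end ReflConj

end Triple

theorem eq_generateFrom_of_coord_mem {G : Set (Set X)} (hG : ∀ S ∈ G, MeasurableSet S)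
    (coord_mem : ∀ (k : ℕ) (t : ZMod 2), {x : X | x k = t} ∈ G) :
    (inferInstance : MeasurableSpace X) = MeasurableSpace.generateFrom G := by
  refine le_antisymm (iSup_le fun k => ?_) (MeasurableSpace.generateFrom_le hG)
  rw [← measurable_iff_comap_le]
  exact @measurable_to_countable' _ _ _ _ (MeasurableSpace.generateFrom G) _ fun t =>
    MeasurableSpace.measurableSet_generateFrom (coord_mem k t)

theorem indicator_coord_eq (k : ℕ) (t : ZMod 2) (x : X) (v : E) :
    {x : X | x k = t}.indicator (fun _ => v) x =
      (2⁻¹ : ℂ) • (v + ((-1 : ℂ) ^ t.val * sign k x) • v) := by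
  by_cases h : x k = t
  · have sign_eq : (-1 : ℂ) ^ t.val * sign k x = 1 := by rw [← h]; exact sign_mul_self k x
    rw [Set.indicator_of_mem (by exact h), sign_eq]
    module
  · have sign_eq : (-1 : ℂ) ^ t.val * sign k x = -1 := by
      rw [sign_eq_neg_of_ne (y := fun _ => t) h, mul_neg]
      exact congrArg Neg.neg (sign_mul_self k fun _ => t)
    rw [Set.indicator_of_notMem (by exact h), sign_eq]
    module

namespace Triple

variable {D : Triple}

section Restrict

theorem exists_restrict {S : Set X} (hS : MeasurableSet S) (f : D.space) :
    ∃ g : D.space, ∀ᵐ x ∂D.μ, g x = S.indicator f x := by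
  refine exists_space ((Lp.memLp (f : Lp E 2 D.μ)).indicator hS) ?_
  filter_upwards [apply_mem_fiber f] with x hx
  exact Set.indicator_rel_indicator (r := fun v _ => v ∈ fiber (D.ν x)) (g := fun _ => (0 : E))
    (Submodule.zero_mem _) fun _ => hx

/-- Multiplication by the indicator function of a measurable set. -/
def restrict {S : Set X} (hS : MeasurableSet S) (f : D.space) : D.space :=
  (exists_restrict hS f).choose

theorem restrict_apply {S : Set X} (hS : MeasurableSet S) (f : D.space) :
    ∀ᵐ x ∂D.μ, restrict hS f x = S.indicator (fun _ => f x) x :=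
  (exists_restrict hS f).choose_spec

theorem restrict_restrict {S T : Set X} (hS : MeasurableSet S) (hT : MeasurableSet T)
    (f : D.space) : restrict hS (restrict hT f) = restrict (hS.inter hT) f := by
  refine space_ext ?_
  filter_upwards [restrict_apply hS (restrict hT f), restrict_apply hT f,
    restrict_apply (hS.inter hT) f] with x hST hT hinter
  rw [hST, hinter, hT]
  by_cases hx : x ∈ S <;> by_cases hx' : x ∈ T <;> simp [hx, hx']

theorem lintegral_enorm_sq (f : D.space) : ∫⁻ x, ‖f x‖ₑ ^ 2 ∂D.μ = ‖f‖ₑ ^ 2 := by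
  have enorm_eq : ‖f‖ₑ = eLpNorm f 2 D.μ := Lp.enorm_def (f : Lp E 2 D.μ)
  rw [enorm_eq, eLpNorm_eq_lintegral_rpow_enorm_toReal two_ne_zero ENNReal.ofNat_ne_top,
    ENNReal.toReal_ofNat, ← ENNReal.rpow_natCast, ← ENNReal.rpow_mul]
  norm_num

theorem setLIntegral_enorm_sq {S : Set X} (hS : MeasurableSet S) (f : D.space) :
    ∫⁻ x in S, ‖f x‖ₑ ^ 2 ∂D.μ = ‖restrict hS f‖ₑ ^ 2 := by
  rw [← lintegral_enorm_sq, ← lintegral_indicator hS]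
  refine lintegral_congr_ae ?_
  filter_upwards [restrict_apply hS f] with x hx
  rw [hx]
  by_cases h : x ∈ S <;> simp [h]

theorem measurable_enorm_sq (f : D.space) : Measurable fun x => ‖f x‖ₑ ^ 2 :=
  (Lp.stronglyMeasurable (f : Lp E 2 D.μ)).enorm.pow_const 2

instance (f : D.space) : IsFiniteMeasure (D.μ.withDensity fun x => ‖f x‖ₑ ^ 2) :=
  isFiniteMeasure_withDensity (by simp [lintegral_enorm_sq])

end Restrict

section SignOp

/-- Multiplication by the sign `(-1) ^ x_k`, written in terms of the Clifford action. -/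
def signOp (k : ℕ) (f : D.space) : D.space :=
  Complex.I • D.basisOp (.inr k) (D.basisOp (.inl k) f)

theorem signOp_apply (k : ℕ) (f : D.space) : ∀ᵐ x ∂D.μ, signOp k f x = sign k x • f x := by
  filter_upwards [coeFn_smul Complex.I (D.basisOp (.inr k) (D.basisOp (.inl k) f)),
    basisOp_basisOp_apply (.inr k) (.inl k) f, apply_mem_fiber f, c_apply_c_add_delta k,
    (D.quasiInvolution_add_delta k).sqrtDensity_mul_self] with x hI hJJ hf hc hw
  have phase_eq : phase (.inr k) x * phase (.inl k) (x + delta k) = -Complex.I * sign k x := by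
    rw [phase_inr, phase, partialSign_add_delta_of_le le_rfl]
    linear_combination (-sign k x * Complex.I) * partialSign_mul_self k x
  simp only [flipIndex, Sum.elim_inl, Sum.elim_inr, id] at hJJ
  rw [signOp, hI, hJJ, hw, phase_eq, ContinuousLinearMap.comp_apply, add_delta_add_delta, hc _ hf,
    Complex.ofReal_one, one_smul, smul_smul, ← mul_assoc, mul_neg, Complex.I_mul_I, neg_neg,
    one_mul]

theorem restrict_coord (k : ℕ) (t : ZMod 2) (hS : MeasurableSet {x : X | x k = t}) (f : D.space) :
    restrict hS f = (2⁻¹ : ℂ) • (f + (-1 : ℂ) ^ t.val • signOp k f) := by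
  refine space_ext ?_
  filter_upwards [restrict_apply hS f, signOp_apply k f,
    coeFn_smul (2⁻¹ : ℂ) (f + (-1 : ℂ) ^ t.val • signOp k f),
    coeFn_add f ((-1 : ℂ) ^ t.val • signOp k f), coeFn_smul ((-1 : ℂ) ^ t.val) (signOp k f)]
    with x hr hs h₁ h₂ h₃
  rw [hr, h₁, h₂, h₃, hs, indicator_coord_eq, smul_smul ((-1 : ℂ) ^ t.val)]

theorem restrict_one_sub_coord (k : ℕ) (t : ZMod 2)
    (hS : MeasurableSet ((fun x => 1 - x) ⁻¹' {x : X | x k = t})) (f : D.space) :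
    restrict hS f = (2⁻¹ : ℂ) • (f - (-1 : ℂ) ^ t.val • signOp k f) := by
  refine space_ext ?_
  filter_upwards [restrict_apply hS f, signOp_apply k f,
    coeFn_smul (2⁻¹ : ℂ) (f - (-1 : ℂ) ^ t.val • signOp k f),
    coeFn_sub f ((-1 : ℂ) ^ t.val • signOp k f), coeFn_smul ((-1 : ℂ) ^ t.val) (signOp k f)]
    with x hr hs h₁ h₂ h₃
  have := indicator_coord_eq k t (1 - x) (f x)
  rw [sign_one_sub, mul_neg, neg_smul, ← sub_eq_add_neg] at this
  rw [hr, h₁, h₂, h₃, hs, smul_smul ((-1 : ℂ) ^ t.val), ← this]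
  rfl

end SignOp

section Localization

/-- The sets whose restriction operators are carried by `C` to those of the reflected sets. -/
def reflSets (C : D.space → D.space) : Set (Set X) :=
  {S | ∃ hS : MeasurableSet S, ∀ f, C (restrict hS f) = restrict (measurable_one_sub hS) (C f)}

theorem isPiSystem_reflSets (C : D.space → D.space) : IsPiSystem (reflSets C) := by
  rintro S ⟨hS, hCS⟩ T ⟨hT, hCT⟩ -
  refine ⟨hS.inter hT, fun f => ?_⟩
  rw [← restrict_restrict hS hT, hCS, hCT, restrict_restrict]
  rfl

variable {C : D.space →ₛₗᵢ[starRingEnd ℂ] D.space}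

theorem conj_signOp (hC : ∀ i, (D.basisOp i).toContinuousLinearMap ∈ commutant C) (k : ℕ)
    (f : D.space) : C (signOp k f) = -signOp k (C f) := by
  have C_basisOp (i : ℕ ⊕ ℕ) (f : D.space) : C (D.basisOp i f) = D.basisOp i (C f) := hC i f
  rw [signOp, C.map_smulₛₗ, C_basisOp, C_basisOp, Complex.conj_I, neg_smul, signOp]

theorem coord_mem_reflSets (hC : ∀ i, (D.basisOp i).toContinuousLinearMap ∈ commutant C) (k : ℕ)
    (t : ZMod 2) : {x : X | x k = t} ∈ reflSets C := by
  have measurableSet_coord : MeasurableSet {x : X | x k = t} :=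
    measurableSet_eq_fun (measurable_pi_apply k) measurable_const
  refine ⟨measurableSet_coord, fun f => ?_⟩
  rw [restrict_coord, restrict_one_sub_coord, C.map_smulₛₗ, map_add, C.map_smulₛₗ, conj_signOp hC,
    smul_neg, ← sub_eq_add_neg]
  simp only [map_inv₀, map_ofNat, map_pow, map_neg, map_one]

theorem map_withDensity_conj (hC : ∀ i, (D.basisOp i).toContinuousLinearMap ∈ commutant C)
    (f : D.space) : (D.μ.withDensity fun x => ‖C f x‖ₑ ^ 2).map (fun x => 1 - x) =
      D.μ.withDensity fun x => ‖f x‖ₑ ^ 2 := by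
  have enorm_C (g : D.space) : ‖C g‖ₑ = ‖g‖ₑ := C.enorm_map g
  refine ext_of_generate_finite _
    (eq_generateFrom_of_coord_mem (fun S hS => hS.1) (coord_mem_reflSets hC))
    (isPiSystem_reflSets C) ?_ ?_
  · rintro S ⟨hS, hCS⟩
    rw [Measure.map_apply measurable_one_sub hS, withDensity_apply _ (measurable_one_sub hS),
      withDensity_apply _ hS, setLIntegral_enorm_sq hS,
      setLIntegral_enorm_sq (measurable_one_sub hS), ← hCS, enorm_C]
  · rw [Measure.map_apply measurable_one_sub .univ, Set.preimage_univ, withDensity_apply _ .univ,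
      withDensity_apply _ .univ, Measure.restrict_univ, lintegral_enorm_sq, lintegral_enorm_sq,
      enorm_C]

theorem quasiInvolution_one_sub (hC : ∀ i, (D.basisOp i).toContinuousLinearMap ∈ commutant C) :
    QuasiInvolution (fun x : X => 1 - x) D.μ := by
  have involutive : Function.Involutive fun x : X => 1 - x := sub_sub_cancel 1
  have ac_withDensity : D.μ ≪ D.μ.withDensity fun x => ‖D.frame 0 x‖ₑ ^ 2 := by
    refine withDensity_absolutelyContinuous' (measurable_enorm_sq _).aemeasurable ?_
    filter_upwards [frame_apply (D := D)] with x hx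
    have hν : ((0 : ℕ) : ℕ∞) < D.ν x := zero_lt_one.trans_le (D.one_le_ν x)
    rw [hx, if_pos hν]
    simp [(D.cutoff_pos x).ne', stdBasis.orthonormal.ne_zero]
  rw [← map_withDensity_conj hC] at ac_withDensity
  have ac_map : D.μ ≪ D.μ.map fun x => 1 - x :=
    ac_withDensity.trans ((withDensity_absolutelyContinuous _ _).map measurable_one_sub)
  have map_ac := ac_map.map measurable_one_sub
  rw [Measure.map_map measurable_one_sub measurable_one_sub, involutive.comp_self,
    Measure.map_id] at map_ac
  exact ⟨⟨measurable_one_sub, map_ac⟩, involutive⟩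

theorem norm_conj_one_sub (hC : ∀ i, (D.basisOp i).toContinuousLinearMap ∈ commutant C)
    (f : D.space) :
    ∀ᵐ x ∂D.μ, sqrtDensity D.μ (fun y => 1 - y) x * ‖C f (1 - x)‖ = ‖f x‖ := by
  have hφ := quasiInvolution_one_sub hC
  have density_eq := map_withDensity_conj hC f
  rw [hφ.map_withDensity (measurable_enorm_sq _)] at density_eq
  have density_ae_eq := (withDensity_eq_iff
    ((Measure.measurable_rnDeriv _ _).mul
      ((measurable_enorm_sq (C f)).comp measurable_one_sub)).aemeasurable
    (measurable_enorm_sq f).aemeasurable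
    (by
      refine ne_of_eq_of_ne (hφ.lintegral_rnDeriv_mul_comp (measurable_enorm_sq _)) ?_
      simp [lintegral_enorm_sq])).1 density_eq
  filter_upwards [density_ae_eq, hφ.ofReal_sqrtDensity_sq] with x hx hw
  rw [Pi.mul_apply, Function.comp_apply] at hx
  have hnonneg := sqrtDensity_nonneg (μ := D.μ) (fun y => 1 - y) x
  rw [← hw, ← ofReal_norm, ← ofReal_norm, ← ENNReal.ofReal_pow (norm_nonneg _),
    ← ENNReal.ofReal_pow (norm_nonneg _), ← ENNReal.ofReal_mul (sq_nonneg _),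
    ENNReal.ofReal_eq_ofReal_iff (by positivity) (sq_nonneg _), ← mul_pow] at hx
  exact (sq_eq_sq₀ (mul_nonneg hnonneg (norm_nonneg _)) (norm_nonneg _)).1 hx

end Localization

end Triple

theorem eq_map_of_inner_map_stdBasis {A : E →ₗᵢ[ℂ] E} {v w : E} (norm_eq : ‖w‖ = ‖v‖)
    (inner_eq : ∀ i, inner ℂ (A (stdBasis i)) w = v i) : w = A v := by
  have adjoint_eq : A.toContinuousLinearMap.adjoint w = v := by
    ext i
    rw [← inner_stdBasis, ContinuousLinearMap.adjoint_inner_right]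
    exact inner_eq i
  rw [← sub_eq_zero, ← norm_eq_zero, ← sq_eq_zero_iff, norm_sub_sq (𝕜 := ℂ), norm_eq, A.norm_map,
    ← A.coe_toContinuousLinearMap, ← ContinuousLinearMap.adjoint_inner_left, adjoint_eq,
    inner_self_eq_norm_sq]
  ring

theorem surjective_of_stdBasis_mem_range {A : E →ₗᵢ[ℂ] E}
    (h : ∀ i, stdBasis i ∈ Set.range A) : Function.Surjective A := by
  have isClosed_range : IsClosed (A.toLinearMap.range : Set E) :=
    A.isometry.isClosedEmbedding.isClosed_range
  rw [← Set.range_eq_univ]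
  refine Set.eq_univ_of_univ_subset fun v _ => ?_
  exact Submodule.topologicalClosure_minimal _
    (Submodule.span_le.2 (Set.range_subset_iff.2 h)) isClosed_range
    (stdBasis.dense_span ▸ Submodule.mem_top)

theorem exists_linearIsometry_stdBasis {u : ℕ → E} (hu : Orthonormal ℂ u) :
    ∃ A : E →ₗᵢ[ℂ] E, ∀ i, A (stdBasis i) = u i := by
  refine ⟨hu.orthogonalFamily.linearIsometry, fun i => ?_⟩
  rw [show stdBasis i = lp.single 2 i (1 : ℂ) from by rw [← stdBasis.repr_self]; rfl,
    hu.orthogonalFamily.linearIsometry_apply_single, LinearIsometry.toSpanSingleton_apply,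
    one_smul]

theorem le_of_linearIndependent_of_mem_fiber {n : ℕ} {m : ℕ∞} {a : Fin n → E}
    (ha : LinearIndependent ℂ a) (mem : ∀ i, a i ∈ fiber m) : (n : ℕ∞) ≤ m := by
  induction m using ENat.recTopCoe with
  | top => exact le_top
  | coe M =>
    let coords : fiber M →ₗ[ℂ] (Fin M → ℂ) :=
      { toFun := fun v i => (v : E) i
        map_add' := fun _ _ => rfl
        map_smul' := fun _ _ => rfl }
    have ker_coords : coords.ker = ⊥ := by
      refine LinearMap.ker_eq_bot'.2 fun v hv => Subtype.ext (lp.ext (funext fun i => ?_))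
      rcases lt_or_ge i M with hi | hi
      · exact congrFun hv ⟨i, hi⟩
      · exact v.2 i (Nat.cast_le.2 hi)
    have indep : LinearIndependent ℂ fun i => (⟨a i, mem i⟩ : fiber M) :=
      .of_comp (fiber M).subtype ha
    simpa using (indep.map' coords ker_coords).fintype_card_le_finrank

namespace Triple

variable {D : Triple}

/-- The composition of `C` with the standard conjugation, defined without assuming that the fibres
over `x` and `1 - x` have the same dimension. -/
def reflComp (C : D.space → D.space) (f : D.space) (x : X) : E :=
  ((sqrtDensity D.μ (fun y => 1 - y) x : ℝ) : ℂ) • star (C f (1 - x))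

/-- The orthonormal basis to which `reflComp C`, seen as a field of operators, moves the standard
one. -/
def movedBasis (C : D.space → D.space) (i : ℕ) (x : X) : E :=
  if (i : ℕ∞) < D.ν x then (D.cutoff x : ℂ)⁻¹ • reflComp C (D.frame i) x else stdBasis i

/-- A measurable field of unitary operators of the fibres, each extended by the identity to the
orthogonal complement of its fibre. -/
structure UnitaryField (D : Triple) where
  toFun : X → E ≃ₗᵢ[ℂ] E
  aestronglyMeasurable_stdBasis : ∀ i, AEStronglyMeasurable (fun x => toFun x (stdBasis i)) D.μ
  apply_stdBasis : ∀ᵐ x ∂D.μ, ∀ i : ℕ, D.ν x ≤ i → toFun x (stdBasis i) = stdBasis i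

instance : CoeFun D.UnitaryField fun _ => X → E ≃ₗᵢ[ℂ] E := ⟨UnitaryField.toFun⟩

section Decomposition

variable {C : D.space →ₛₗᵢ[starRingEnd ℂ] D.space}
  (hC : ∀ i, (D.basisOp i).toContinuousLinearMap ∈ commutant C)

include hC

theorem norm_reflComp (f : D.space) : ∀ᵐ x ∂D.μ, ‖reflComp C f x‖ = ‖f x‖ := by
  filter_upwards [norm_conj_one_sub hC f] with x hx
  rw [reflComp, norm_smul, norm_star, Complex.norm_real,
    Real.norm_of_nonneg (sqrtDensity_nonneg _ _), hx]

theorem reflComp_add (f g : D.space) :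
    ∀ᵐ x ∂D.μ, reflComp C (f + g) x = reflComp C f x + reflComp C g x := by
  filter_upwards [(quasiInvolution_one_sub hC).ae (coeFn_add (C f) (C g))] with x hx
  rw [reflComp, map_add, hx, star_add, smul_add, reflComp, reflComp]

theorem reflComp_smul (a : ℂ) (f : D.space) :
    ∀ᵐ x ∂D.μ, reflComp C (a • f) x = a • reflComp C f x := by
  filter_upwards [(quasiInvolution_one_sub hC).ae (coeFn_smul (starRingEnd ℂ a) (C f))] with x hx
  rw [reflComp, C.map_smulₛₗ, hx, star_smul, smul_comm, starRingEnd_apply, star_star, reflComp]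

theorem norm_reflComp_add_smul (f g : D.space) (a : ℂ) :
    ∀ᵐ x ∂D.μ, ‖reflComp C f x + a • reflComp C g x‖ = ‖f x + a • g x‖ := by
  filter_upwards [norm_reflComp hC (f + a • g), reflComp_add hC f (a • g), reflComp_smul hC a g,
    coeFn_add f (a • g), coeFn_smul a g] with x hnorm hadd hsmul hadd' hsmul'
  rwa [hadd, hsmul, hadd', hsmul'] at hnorm

theorem inner_reflComp (f g : D.space) :
    ∀ᵐ x ∂D.μ, inner ℂ (reflComp C f x) (reflComp C g x) = inner ℂ (f x) (g x) := by
  filter_upwards [norm_reflComp_add_smul hC f g 1, norm_reflComp_add_smul hC f g (-1),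
    norm_reflComp_add_smul hC f g Complex.I, norm_reflComp_add_smul hC f g (-Complex.I)]
    with x h₁ h₂ h₃ h₄
  simp only [one_smul, neg_smul, ← sub_eq_add_neg] at h₁ h₂ h₃ h₄
  simp only [inner_eq_sum_norm_sq_div_four (𝕜 := ℂ), RCLike.I_to_complex, h₁, h₂, h₃, h₄]

theorem reflComp_mem_fiber (f : D.space) :
    ∀ᵐ x ∂D.μ, reflComp C f x ∈ fiber (D.ν (1 - x)) := by
  filter_upwards [(quasiInvolution_one_sub hC).ae (apply_mem_fiber (C f))] with x hx
  exact Submodule.smul_mem _ _ (star_mem_fiber hx)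

theorem aestronglyMeasurable_reflComp (f : D.space) :
    AEStronglyMeasurable (reflComp C f) D.μ :=
  (Complex.measurable_ofReal.comp (measurable_sqrtDensity _)).aestronglyMeasurable.smul
    ((aestronglyMeasurable_coe (C f)).comp_quasiMeasurePreserving
      (quasiInvolution_one_sub hC).toQuasiMeasurePreserving).star

theorem inner_movedBasis_reflComp (f : D.space) : ∀ᵐ x ∂D.μ, ∀ i : ℕ, (i : ℕ∞) < D.ν x →
    inner ℂ (movedBasis C i x) (reflComp C f x) = f x i := by
  filter_upwards [frame_apply, ae_all_iff.2 fun i => inner_reflComp hC (D.frame i) f]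
    with x hframe hinner i hi
  rw [movedBasis, if_pos hi, inner_smul_left, hinner, hframe, if_pos hi, inner_smul_left,
    inner_stdBasis, map_inv₀, Complex.conj_ofReal, inv_mul_cancel_left₀ (D.ofReal_cutoff_ne_zero x)]

theorem movedBasis_mem_fiber : ∀ᵐ x ∂D.μ, ∀ i : ℕ, (i : ℕ∞) < D.ν x →
    movedBasis C i x ∈ fiber (D.ν (1 - x)) := by
  filter_upwards [ae_all_iff.2 fun i => reflComp_mem_fiber hC (D.frame i)] with x hx i hi
  rw [movedBasis, if_pos hi]
  exact Submodule.smul_mem _ _ (hx i)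

theorem inner_movedBasis_movedBasis : ∀ᵐ x ∂D.μ, ∀ i j : ℕ, (i : ℕ∞) < D.ν x →
    (j : ℕ∞) < D.ν x → inner ℂ (movedBasis C i x) (movedBasis C j x) = if i = j then 1 else 0 := by
  filter_upwards [ae_all_iff.2 fun j => inner_movedBasis_reflComp hC (D.frame j), frame_apply]
    with x hinner hframe i j hi hj
  rw [movedBasis.eq_def C j, if_pos hj, inner_smul_right, hinner j i hi, hframe, if_pos hj,
    lp.coeFn_smul, Pi.smul_apply, smul_eq_mul, inv_mul_cancel_left₀ (D.ofReal_cutoff_ne_zero x),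
    stdBasis_apply]
  simp only [eq_comm]

theorem isReflInvariant_of_mem_commutant : D.IsReflInvariant := by
  have ν_le : ∀ᵐ x ∂D.μ, D.ν x ≤ D.ν (1 - x) := by
    filter_upwards [movedBasis_mem_fiber hC, inner_movedBasis_movedBasis hC] with x mem inner_eq
    refine ENat.forall_natCast_le_iff_le.1 fun n hn => ?_
    have lt_ν (i : Fin n) : ((i : ℕ) : ℕ∞) < D.ν x := (Nat.cast_lt.2 i.2).trans_le hn
    have orthonormal : Orthonormal ℂ fun i : Fin n => movedBasis C i x :=
      orthonormal_iff_ite.2 fun i j => by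
        simp only [inner_eq i j (lt_ν i) (lt_ν j), Fin.ext_iff]
    exact le_of_linearIndependent_of_mem_fiber orthonormal.linearIndependent
      fun i => mem i (lt_ν i)
  refine ⟨quasiInvolution_one_sub hC, ?_⟩
  filter_upwards [ν_le, (quasiInvolution_one_sub hC).ae ν_le] with x hx hx'
  rw [sub_sub_cancel] at hx'
  exact le_antisymm hx' hx

theorem orthonormal_movedBasis : ∀ᵐ x ∂D.μ, Orthonormal ℂ fun i => movedBasis C i x := by
  filter_upwards [movedBasis_mem_fiber hC, inner_movedBasis_movedBasis hC,
    (isReflInvariant_of_mem_commutant hC).ν_one_sub] with x mem inner_eq hν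
  rw [hν] at mem
  have of_ge {i : ℕ} (hi : D.ν x ≤ i) : movedBasis C i x = stdBasis i := if_neg hi.not_gt
  rw [orthonormal_iff_ite]
  intro i j
  rcases lt_or_ge (i : ℕ∞) (D.ν x) with hi | hi <;> rcases lt_or_ge (j : ℕ∞) (D.ν x) with hj | hj
  · exact inner_eq i j hi hj
  · rw [of_ge hj, if_neg (by rintro rfl; exact hi.not_ge hj)]
    exact (stdBasis_mem_fiber_orthogonal hj) _ (mem i hi)
  · rw [of_ge hi, if_neg (by rintro rfl; exact hj.not_ge hi), inner_stdBasis]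
    exact mem j hj i hi
  · rw [of_ge hi, of_ge hj, orthonormal_iff_ite.1 stdBasis.orthonormal]

theorem aestronglyMeasurable_movedBasis (i : ℕ) : AEStronglyMeasurable (movedBasis C i) D.μ := by
  classical
  have piecewise := AEStronglyMeasurable.piecewise (D.measurableSet_lt_ν i)
    ((Complex.measurable_ofReal.comp D.measurable_cutoff).inv.aestronglyMeasurable.smul
      (aestronglyMeasurable_reflComp hC (D.frame i))).restrict
    (aestronglyMeasurable_const (b := stdBasis i)).restrict
  exact piecewise

theorem reflComp_eq_of_movedBasis (f : D.space) : ∀ᵐ x ∂D.μ, ∀ A : E →ₗᵢ[ℂ] E,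
    (∀ i, A (stdBasis i) = movedBasis C i x) → reflComp C f x = A (f x) := by
  filter_upwards [inner_movedBasis_reflComp hC f, norm_reflComp hC f, reflComp_mem_fiber hC f,
    apply_mem_fiber f, (isReflInvariant_of_mem_commutant hC).ν_one_sub]
    with x inner_eq norm_eq mem mem' hν A hA
  rw [hν] at mem
  refine eq_map_of_inner_map_stdBasis norm_eq fun i => ?_
  rw [hA]
  rcases lt_or_ge (i : ℕ∞) (D.ν x) with hi | hi
  · exact inner_eq i hi
  · rw [movedBasis, if_neg hi.not_gt, inner_stdBasis, mem i hi, mem' i hi]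

theorem stdBasis_mem_range_of_movedBasis (hC' : Function.Involutive C) :
    ∀ᵐ x ∂D.μ, ∀ A : E →ₗᵢ[ℂ] E, (∀ i, A (stdBasis i) = movedBasis C i x) →
      ∀ i, stdBasis i ∈ Set.range A := by
  have h := isReflInvariant_of_mem_commutant hC
  filter_upwards [ae_all_iff.2 fun i => reflComp_eq_of_movedBasis hC (C (D.frame i)),
    h.quasiInvolution.ae frame_apply, h.ν_one_sub, h.quasiInvolution.sqrtDensity_pos]
    with x reflComp_eq hframe hν hw A hA i
  rcases lt_or_ge (i : ℕ∞) (D.ν x) with hi | hi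
  · have A_apply := reflComp_eq i A hA
    rw [reflComp, hC', hframe, hν, if_pos hi, star_smul, star_stdBasis, smul_smul] at A_apply
    exact (Submodule.smul_mem_iff A.toLinearMap.range (mul_ne_zero
      (Complex.ofReal_ne_zero.2 hw.ne') (star_ne_zero.2 (D.ofReal_cutoff_ne_zero _)))).1
      ⟨_, A_apply.symm⟩
  · exact ⟨stdBasis i, by rw [hA, movedBasis, if_neg hi.not_gt]⟩

theorem exists_unitaryField (hC' : Function.Involutive C) :
    ∃ A : D.UnitaryField, ∀ f, ∀ᵐ x ∂D.μ, reflComp C f x = A x (f x) := by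
  have pointwise : ∀ᵐ x ∂D.μ, ∃ A : E ≃ₗᵢ[ℂ] E, ∀ i, A (stdBasis i) = movedBasis C i x := by
    filter_upwards [orthonormal_movedBasis hC, stdBasis_mem_range_of_movedBasis hC hC']
      with x orthonormal mem_range
    obtain ⟨A, hA⟩ := exists_linearIsometry_stdBasis orthonormal
    exact ⟨.ofSurjective A (surjective_of_stdBasis_mem_range (mem_range A hA)), hA⟩
  let A (x : X) : E ≃ₗᵢ[ℂ] E := Classical.epsilon fun A => ∀ i, A (stdBasis i) = movedBasis C i x
  have A_stdBasis : ∀ᵐ x ∂D.μ, ∀ i, A x (stdBasis i) = movedBasis C i x :=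
    pointwise.mono fun x hx => Classical.epsilon_spec hx
  refine ⟨⟨A, fun i => ?_, ?_⟩, fun f => ?_⟩
  · exact (aestronglyMeasurable_movedBasis hC i).congr (A_stdBasis.mono fun x hx => (hx i).symm)
  · filter_upwards [A_stdBasis] with x hx i hi
    rw [hx, movedBasis, if_neg hi.not_gt]
  · filter_upwards [A_stdBasis, reflComp_eq_of_movedBasis hC f] with x hx reflComp_eq
    exact reflComp_eq (A x).toLinearIsometry hx

end Decomposition

end Triple

theorem apply_mem_fiber_iff_of_stdBasis {n : ℕ∞} {A : E ≃ₗᵢ[ℂ] E}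
    (hA : ∀ i : ℕ, n ≤ i → A (stdBasis i) = stdBasis i) (v : E) :
    A v ∈ fiber n ↔ v ∈ fiber n := by
  have apply_eq (i : ℕ) (hi : n ≤ i) : A v i = v i := by
    rw [← inner_stdBasis, ← inner_stdBasis i v, ← A.inner_map_map (stdBasis i) v, hA i hi]
  exact forall₂_congr fun i hi => by rw [apply_eq i hi]

theorem IsUnitaryOn.conj {F : Submodule ℂ E} {T : E →L[ℂ] E} (hT : IsUnitaryOn F T)
    {A B : E ≃ₗᵢ[ℂ] E} (hA : ∀ v, A v ∈ F ↔ v ∈ F) (hB : ∀ v, B v ∈ F ↔ v ∈ F) :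
    IsUnitaryOn F ((A : E →L[ℂ] E) ∘L T ∘L (B.symm : E →L[ℂ] E)) := by
  have hA' (v : E) : A.symm v ∈ F ↔ v ∈ F := by rw [← hA, A.apply_symm_apply]
  have hB' (v : E) : B.symm v ∈ F ↔ v ∈ F := by rw [← hB, B.apply_symm_apply]
  refine ⟨fun v hv => ?_, le_antisymm ?_ fun w hw => ?_, fun v hv => ?_⟩
  · exact (A.norm_map _).trans ((hT.norm_map _ ((hB' v).2 hv)).trans (B.symm.norm_map v))
  · rintro _ ⟨v, hv, rfl⟩
    exact (hA _).2 (hT.apply_mem ((hB' v).2 hv))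
  · obtain ⟨u, hu, hTu⟩ := hT.map_eq.ge ((hA' w).2 hw)
    refine ⟨B u, (hB u).2 hu, ?_⟩
    change A (T (B.symm (B u))) = w
    rw [B.symm_apply_apply]
    exact A.eq_symm_apply.1 hTu
  · have mem_orthogonal : B.symm v ∈ Fᗮ := fun u hu => by
      rw [← B.inner_map_map, B.apply_symm_apply]
      exact hv _ ((hB u).2 hu)
    change A (T (B.symm v)) = 0
    rw [hT.map_orthogonal _ mem_orthogonal, map_zero]

namespace Triple

variable {D : Triple}

namespace UnitaryField

theorem apply_mem_fiber_iff (W : D.UnitaryField) :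
    ∀ᵐ x ∂D.μ, ∀ v, W x v ∈ fiber (D.ν x) ↔ v ∈ fiber (D.ν x) := by
  filter_upwards [W.apply_stdBasis] with x hx
  exact apply_mem_fiber_iff_of_stdBasis hx

theorem aestronglyMeasurable_symm_apply (W : D.UnitaryField) (v : E) :
    AEStronglyMeasurable (fun x => (W x).symm v) D.μ := by
  refine (aestronglyMeasurable_adjoint stdBasis (A := fun x => (W x : E →L[ℂ] E))
    W.aestronglyMeasurable_stdBasis v).congr (.of_forall fun x => ?_)
  change ((W x : E →L[ℂ] E).adjoint) v = _
  rw [LinearIsometryEquiv.adjoint_eq_symm]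
  rfl

/-- The triple with the operators `W(x) c_k(x) W(x + δ_k)*`. -/
def twist (W : D.UnitaryField) : Triple where
  μ := D.μ
  sigmaFinite := D.sigmaFinite
  quasiInvariant := D.quasiInvariant
  ν := D.ν
  measurable_ν := D.measurable_ν
  one_le_ν := D.one_le_ν
  ν_add := D.ν_add
  c k x := (W x : E →L[ℂ] E) ∘L D.c k x ∘L ((W (x + delta k)).symm : E →L[ℂ] E)
  measurable_c k v :=
    aestronglyMeasurable_apply stdBasis (A := fun x => (W x : E →L[ℂ] E))
      W.aestronglyMeasurable_stdBasis <|
    aestronglyMeasurable_apply stdBasis (A := D.c k) (fun i => D.measurable_c k (stdBasis i)) <|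
    (W.aestronglyMeasurable_symm_apply v).comp_quasiMeasurePreserving
      (D.quasiInvolution_add_delta k).toQuasiMeasurePreserving
  unitary_c k := by
    filter_upwards [D.unitary_c k, W.apply_mem_fiber_iff,
      (D.quasiInvolution_add_delta k).ae W.apply_mem_fiber_iff, D.ν_add _ (delta_mem_Delta k)]
      with x hc hW hW' hν
    rw [hν] at hW'
    exact hc.conj hW hW'
  adjoint_c k := by
    filter_upwards [D.adjoint_c k] with x hc
    rw [ContinuousLinearMap.adjoint_comp, ContinuousLinearMap.adjoint_comp,
      LinearIsometryEquiv.adjoint_eq_symm, LinearIsometryEquiv.adjoint_eq_symm, hc,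
      add_delta_add_delta, LinearIsometryEquiv.symm_symm, ContinuousLinearMap.comp_assoc]
  comm_c k l := by
    filter_upwards [D.comm_c k l] with x hc
    ext1 v
    have := congrArg (W x) (DFunLike.congr_fun hc ((W (x + delta k + delta l)).symm v))
    simpa [add_right_comm x (delta l)] using this

theorem exists_unitary (W : D.UnitaryField) :
    ∃ U : D.space ≃ₗᵢ[ℂ] W.twist.space, ∀ f : D.space, ∀ᵐ x ∂D.μ, U f x = W x (f x) := by
  obtain ⟨T, hT⟩ := exists_weightedComp (.id D.μ) (A := fun x => (W x : E →L[ℂ] E))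
    W.aestronglyMeasurable_stdBasis (W.apply_mem_fiber_iff.mono fun x hx v hv => (hx v).2 hv)
    (.of_forall fun x v _ => (W x).norm_map v)
  obtain ⟨S, hS⟩ := exists_weightedComp (.id D.μ) (A := fun x => ((W x).symm : E →L[ℂ] E))
    (fun i => W.aestronglyMeasurable_symm_apply _)
    (W.apply_mem_fiber_iff.mono fun x hx v hv => by
      change (W x).symm v ∈ fiber (D.ν x)
      rwa [← hx, (W x).apply_symm_apply])
    (.of_forall fun x v _ => (W x).symm.norm_map v)
  have T_apply (f : D.space) : ∀ᵐ x ∂D.μ, T f x = W x (f x) := by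
    filter_upwards [hT f, sqrtDensity_id (μ := D.μ)] with x hx h_one
    rw [hx, h_one, Complex.ofReal_one, one_smul]
    rfl
  have surjective : Function.Surjective T := fun g => by
    refine ⟨S g, space_ext ?_⟩
    filter_upwards [T_apply (S g), hS g, sqrtDensity_id (μ := D.μ)] with x hTx hSx h_one
    rw [hTx, hSx, h_one, Complex.ofReal_one, one_smul]
    exact (W x).apply_symm_apply _
  exact ⟨.ofSurjective T surjective, T_apply⟩

theorem map_basisOp_eq_basisOp_twist (W : D.UnitaryField) {U : D.space ≃ₗᵢ[ℂ] W.twist.space}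
    (hU : ∀ f : D.space, ∀ᵐ x ∂D.μ, U f x = W x (f x)) (i : ℕ ⊕ ℕ) (f : D.space) :
    U (D.basisOp i f) = W.twist.basisOp i (U f) := by
  refine space_ext ?_
  filter_upwards [hU (D.basisOp i f), basisOp_apply i f, basisOp_apply i (U f),
    (D.quasiInvolution_add_delta (flipIndex i)).ae (hU f)] with x hUJ hJ hJU hUf
  rw [hUJ, hJ, hJU, hUf, map_smul, map_smul]
  change _ = _ • _ • W x (D.c _ x ((W _).symm (W _ _)))
  rw [LinearIsometryEquiv.symm_apply_apply]
  rfl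

/-- The field that is the identity where `x₁ = 0` and `A` where `x₁ = 1`. As `x ↦ 1 - x` exchanges
the two halves, it takes the conjugation with the operators `A` to the standard one. -/
def onHalf (A : D.UnitaryField) : D.UnitaryField where
  toFun x := if x 0 = 0 then .refl ℂ E else A x
  aestronglyMeasurable_stdBasis i := by
    have piecewise := AEStronglyMeasurable.piecewise
      (measurableSet_eq_fun (measurable_pi_apply 0) measurable_const :
        MeasurableSet {x : X | x 0 = 0})
      (aestronglyMeasurable_const (b := stdBasis i)).restrict
      (A.aestronglyMeasurable_stdBasis i).restrict
    refine piecewise.congr (.of_forall fun x => ?_)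
    by_cases hx : x 0 = 0 <;> simp [hx]
  apply_stdBasis := by
    filter_upwards [A.apply_stdBasis] with x hx i hi
    split_ifs
    · rfl
    · exact hx i hi

theorem onHalf_apply_conj {C : D.space → D.space} (hC : Function.Involutive C)
    (h : D.IsReflInvariant) {A : D.UnitaryField}
    (hA : ∀ f, ∀ᵐ x ∂D.μ, reflComp C f x = A x (f x)) (f : D.space) :
    ∀ᵐ x ∂D.μ, A.onHalf x (C f x) = ((sqrtDensity D.μ (fun y => 1 - y) x : ℝ) : ℂ) •
      star (A.onHalf (1 - x) (f (1 - x))) := by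
  filter_upwards [hA (C f), h.quasiInvolution.ae (hA f), h.quasiInvolution.sqrtDensity_mul_self]
    with x hx hx' hw
  by_cases h_zero : x 0 = 0
  · have eq_refl : A.onHalf x = .refl ℂ E := if_pos h_zero
    have eq_A : A.onHalf (1 - x) = A (1 - x) := if_neg (by simp [h_zero])
    rw [eq_refl, eq_A, ← hx', reflComp, sub_sub_cancel, star_smul, star_star, smul_smul,
      Complex.star_def, Complex.conj_ofReal, ← Complex.ofReal_mul, hw, Complex.ofReal_one, one_smul]
    rfl
  · have eq_one : x 0 = 1 := Fin.eq_one_of_ne_zero _ h_zero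
    have eq_A : A.onHalf x = A x := if_neg h_zero
    have eq_refl : A.onHalf (1 - x) = .refl ℂ E := if_pos (by simp [eq_one])
    rw [eq_refl, eq_A, ← hx, reflComp, hC]
    rfl

end UnitaryField

section Transport

variable {Z : Type*} [NormedAddCommGroup Z] [InnerProductSpace ℝ Z] {b : Frame Z}
  {ρ : CliffordAlgebra (negForm Z) →ₐ[ℝ] (D.space →L[ℂ] D.space)}

theorem IsRep.exists_conj (hρ : D.IsRep b ρ) {D' : Triple} (U : D.space ≃ₗᵢ[ℂ] D'.space)
    (hU : ∀ i f, U (D.basisOp i f) = D'.basisOp i (U f)) :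
    ∃ ρ' : CliffordAlgebra (negForm Z) →ₐ[ℝ] (D'.space →L[ℂ] D'.space),
      D'.IsRep b ρ' ∧ ∀ a f, U (ρ a f) = ρ' a (U f) := by
  obtain ⟨continuous_ρ, hρJ⟩ := isRep_iff.1 hρ
  let K := U.toContinuousLinearEquiv.conjContinuousAlgEquiv
  have K_apply (T : D.space →L[ℂ] D.space) (f : D.space) : K T (U f) = U (T f) :=
    congrArg (fun g => U (T g)) (U.symm_apply_apply f)
  refine ⟨(K.toAlgEquiv.restrictScalars ℝ).toAlgHom.comp ρ,
    isRep_iff.2 ⟨K.continuous.comp continuous_ρ, fun i => ?_⟩, fun a f => (K_apply _ f).symm⟩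
  refine ContinuousLinearMap.ext fun g => ?_
  obtain ⟨f, rfl⟩ := U.surjective g
  change K (ρ _) (U f) = _
  rw [K_apply, hρJ]
  exact hU i f

theorem exists_isStandard_of_mem_commutant {C : D.space →ₛₗᵢ[starRingEnd ℂ] D.space}
    (hC : ∀ i, (D.basisOp i).toContinuousLinearMap ∈ commutant C)
    (hC' : Function.Involutive C) :
    ∃ (D' : Triple) (h' : D'.IsStandard) (U : D.space ≃ₗᵢ[ℂ] D'.space),
      (∀ i f, U (D.basisOp i f) = D'.basisOp i (U f)) ∧ ∀ f, C f = f ↔ U f ∈ h'.realForm := by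
  obtain ⟨A, hA⟩ := exists_unitaryField hC hC'
  have h := isReflInvariant_of_mem_commutant hC
  have h' : A.onHalf.twist.IsReflInvariant := ⟨h.quasiInvolution, h.ν_one_sub⟩
  obtain ⟨U, hU⟩ := A.onHalf.exists_unitary
  have map_basisOp := A.onHalf.map_basisOp_eq_basisOp_twist hU
  have map_conj (f : D.space) : U (C f) = h'.reflConj (U f) := by
    refine space_ext ?_
    filter_upwards [hU (C f), UnitaryField.onHalf_apply_conj hC' h hA f,
      h.quasiInvolution.ae (hU f), h'.reflConj_apply (U f)] with x hUC hAC hUf hR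
    rw [hUC, hAC, hR, hUf]
    rfl
  have isStandard : A.onHalf.twist.IsStandard := h'.isStandard_iff.2 fun i g => by
    obtain ⟨f, rfl⟩ := U.surjective g
    change h'.reflConj (A.onHalf.twist.basisOp i (U f)) = A.onHalf.twist.basisOp i _
    rw [← map_basisOp, ← map_conj, ← map_conj, ← map_basisOp]
    exact congrArg U (hC i f)
  refine ⟨_, isStandard, U, map_basisOp, fun f => ?_⟩
  rw [isStandard.mem_realForm_iff, ← map_conj, U.injective.eq_iff]

theorem exists_isStandard_of_isInvariantRealForm {V : Submodule ℝ D.space} (hρ : D.IsRep b ρ)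
    (hV : IsInvariantRealForm ρ V) :
    ∃ (D' : Triple) (h' : D'.IsStandard)
      (ρ' : CliffordAlgebra (negForm Z) →ₐ[ℝ] (D'.space →L[ℂ] D'.space))
      (U : D.space ≃ₗᵢ[ℂ] D'.space),
      D'.IsRep b ρ' ∧ (∀ a f, U (ρ a f) = ρ' a (U f)) ∧ (∀ f, f ∈ V ↔ U f ∈ h'.realForm) := by
  obtain ⟨C, involutive, rfl, mem_commutant⟩ := hV.exists_conj
  obtain ⟨D', h', U, map_basisOp, mem_realForm⟩ := exists_isStandard_of_mem_commutant
    ((hρ.forall_mem_iff (isClosed_commutant C)).1 mem_commutant) involutive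
  obtain ⟨ρ', hρ', map_ρ⟩ := hρ.exists_conj U map_basisOp
  exact ⟨D', h', ρ', U, hρ', map_ρ, mem_realForm⟩

end Transport

end Triple

end GW

end

theorem theorem3p9 {Z : Type*} [NormedAddCommGroup Z] [InnerProductSpace ℝ Z]
    (b : GW.Frame Z) :
    -- the formulas attach to every triple exactly one representation of the Clifford algebra
    (∀ D : GW.Triple, ∃! ρ, D.IsRep b ρ) ∧
    -- for a triple of standard type, the displayed real subspace is an invariant real form
    (∀ (D : GW.Triple) (h : D.IsStandard) (ρ), D.IsRep b ρ →
      GW.IsInvariantRealForm ρ h.realForm) ∧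
    -- every module with an invariant real form is unitarily equivalent to one of standard type
    (∀ (D : GW.Triple) (ρ) (V : Submodule ℝ D.space), D.IsRep b ρ → GW.IsInvariantRealForm ρ V →
      ∃ (D' : GW.Triple) (h' : D'.IsStandard)
        (ρ' : CliffordAlgebra (GW.negForm Z) →ₐ[ℝ] (D'.space →L[ℂ] D'.space))
        (U : D.space ≃ₗᵢ[ℂ] D'.space),
        D'.IsRep b ρ' ∧ (∀ a f, U (ρ a f) = ρ' a (U f)) ∧ (∀ f, f ∈ V ↔ U f ∈ h'.realForm)) :=
  ⟨fun D => D.existsUnique_isRep b, fun _ h _ hρ => h.isInvariantRealForm hρ,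
    fun _ _ _ hρ hV => GW.Triple.exists_isStandard_of_isInvariantRealForm hρ hV⟩
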